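/- **Setting.** Let $M$ be a closed term of type $\mathrm{Bool}$ of $\mathrm{PCF}\langle X_1,\dots,X_n\rangle$ (call-by-name PCF with fixpoints $\mathrm Y$ and choices $P\oplus_{X_k}Q$, which reduce to $P$ with label $X_k$ and to $Q$ with label $\overline{X_k}$), given with a simple typing derivation, and let $i\in\{0,1\}$. Put $\mathbb X=\{X_1,\overline{X_1},\dots,X_n,\overline{X_n}\}$. A *trajectory* $M\twoheadrightarrow^{\mu} i$ is a weak head reduction of $M$ to the numeral $i$; its *weight* $\mu\in\mathbb N^{\mathbb X}$ is the monomial of the labels met, and its *word* $w\in\{0,1\}^*$ is the sequence of left/right choices made. Under an assignment $q\in[0,1]^{\mathbb X}$ its probability is $q^\mu$; for $x\in[0,\infty]^{\mathbb X}$ put $\mu\cdot x=\sum_{a\in\mathbb X}\mu(a)x_a$ (with $0\cdot\infty=0$), so that $\mu\cdot(-\ln q)=-\ln q^\mu$. For a set $s$ of monomials (an all-one polynomial), $s_{\min}$ is the set of those vertices of the Newton polytope of $s$ (the convex hull of $s$) that are minimal among these vertices for the pointwise order. The tropical intersection type system $\mathbf P_{\mathrm{trop}}$ derives finite families of typings $\gamma\vdash^{s}M:a$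 with non-idempotent intersection types, by running several derivations of the corresponding system $\mathbf P$ (whose derivations describe single reductions and carry one monomial) in parallel, and by replacing at each product and at each merging of equal typings the resulting polynomial by its $(\cdot)_{\min}$. For a $\mathbf P_{\mathrm{trop}}$-derivation $\pi$ of $M:\langle\vdash^{s}i\rangle$ that refines the simple typing of $M$, let $\mathrm{traj}^i(\pi)$ be the polynomial obtained from $\pi$ by omitting all these minimizations (the trajectories explored by $\pi$). A *traceback* of $s$ assigns to each $\mu\in s$ a word $w_\mu$ of a trajectory $M\twoheadrightarrow^{\mu}i$. For $\mu\in s$ let $$\mathcal N(\mu;s)=\{x\in[0,\infty]^{\mathbb X}\mid \mu\cdot x=\min_{\nu\in s}\nu\cdot x\},\qquad \mathtt{selected\_trajs}^i=\{(\mu,w_\mu,\mathcal N(\mu;s))\mid\mu\in s\}.$$ For $m,p\in\mathbb N$ let $\pi_{m,p}$ denote a $\mathbf P_{\mathrm{trop}}$-derivation of $M:\langle\vdash^{s_{m,p}}i\rangle$ that collects all $\mathbf P$-derivations of $\vdash M:i$ in which the rule for $\mathrm Y$ is used at most $m$ times and in which, for all intersection types $[a_1,\dots,a_r]\multimap b$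 that occur, $r\le p$ and no atom of $a_1,\dots,a_r$ exceeds $p$; that is, the weights of all these $\mathbf P$-derivations are in $\mathrm{traj}^i(\pi_{m,p})$. Given a choice of such derivations for all $m,p$, $\pi_{m,p}$ is called (truly) *stable* if $s_{m',p'}=s_{m,p}$ for all $m'\ge m$, $p'\ge p$, or if $s_{m,p}=T_{\min}$ where $T$ is the set of weights of all trajectories $M\twoheadrightarrow i$. **Theorem.** Derivations $\pi_{m,p}$ exist for all $m,p$. For every $\mathbf P_{\mathrm{trop}}$-derivation $\pi$ of $M:\langle\vdash^s i\rangle$ (in particular for each $\pi_{m,p}$, stable or not) each monomial in $\mathrm{traj}^i(\pi)$ is the weight of a trajectory $M\twoheadrightarrow i$, and a traceback of $s$ exists. For every traceback, the following hold with $T=\mathrm{traj}^i(\pi)$; if moreover $\pi=\pi_{m,p}$ is truly stable, they also hold with $T$ the set of weights of all trajectories $M\twoheadrightarrow i$. 1. The pairs $(\mu,w_\mu)$ in $\mathtt{selected\_trajs}^i$ identify the most likely trajectories in $T$: they are finitely many; each $\mu$ is in $T$ and $w_\mu$ is the word of a trajectory $M\twoheadrightarrow^{\mu}i$; for every $q\in[0,1]^{\mathbb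 X}$, if $T\neq\emptyset$ then some selected $\mu$ satisfies $q^\mu=\max_{\nu\in T}q^\nu$; and a selected $\mu$ maximizes $q^{\mu}$ among the selected monomials if and only if it maximizes it in $T$. 2. The sets $\mathcal N(\mu;s)$ in $\mathtt{selected\_trajs}^i$ consist of exactly all $(-\ln)$-values of the parameters that minimize $\mu$ across $T$: $\mathcal N(\mu;s)=\{x\in[0,\infty]^{\mathbb X}\mid\mu\cdot x\le\nu\cdot x\text{ for all }\nu\in T\}$. Equivalently, for $q\in[0,1]^{\mathbb X}$, $-\ln q\in\mathcal N(\mu;s)$ if and only if $q^\mu=\max_{\nu\in T}q^\nu$. -/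

import Mathlib

open scoped ENNReal Pointwise

/-! ## Parametric PCF -/

/-- Letters: `(k, false)` is the formal variable `X_k` (left choice) and `(k, true)` is its dual
`X̄_k` (right choice). -/
abbrev Letter (n : ℕ) := Fin n × Bool

/-- Monomials, i.e. finite multisets of letters. The product of monomials is `+`, and the
divisibility (pointwise) order is `≤`. -/
abbrev Mono (n : ℕ) := Letter n → ℕ

/-- Terms with `n` parameters, in de Bruijn notation (that is, up to α-equivalence).
`ite M N P` goes to `N` when `M` is `0` and to `P` when `M` is a successor; `fix M` is `Y M`;
`choice k M N` is `M ⊕_{X_k} N`. -/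
inductive Tm (n : ℕ) : Type
  | zero : Tm n
  | succ : Tm n → Tm n
  | pred : Tm n → Tm n
  | ite : Tm n → Tm n → Tm n → Tm n
  | var : ℕ → Tm n
  | lam : Tm n → Tm n
  | app : Tm n → Tm n → Tm n
  | fix : Tm n → Tm n
  | choice : Fin n → Tm n → Tm n → Tm n

namespace Tm

variable {n : ℕ}

/-- Extension of a renaming under a binder. -/
def upRen (f : ℕ → ℕ) : ℕ → ℕ
  | 0 => 0
  | k + 1 => f k + 1

def rename : (ℕ → ℕ) → Tm n → Tm n
  | _, zero => zero
  | f, succ M => succ (rename f M)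
  | f, pred M => pred (rename f M)
  | f, ite M N P => ite (rename f M) (rename f N) (rename f P)
  | f, var k => var (f k)
  | f, lam M => lam (rename (upRen f) M)
  | f, app M N => app (rename f M) (rename f N)
  | f, fix M => fix (rename f M)
  | f, choice k M N => choice k (rename f M) (rename f N)

/-- Extension of a substitution under a binder. -/
def up (σ : ℕ → Tm n) : ℕ → Tm n
  | 0 => var 0
  | k + 1 => rename Nat.succ (σ k)

/-- Simultaneous capture-avoiding substitution. -/
def subst : (ℕ → Tm n) → Tm n → Tm n
  | _, zero => zero
  | σ, succ M => succ (subst σ M)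
  | σ, pred M => pred (subst σ M)
  | σ, ite M N P => ite (subst σ M) (subst σ N) (subst σ P)
  | σ, var k => σ k
  | σ, lam M => lam (subst (up σ) M)
  | σ, app M N => app (subst σ M) (subst σ N)
  | σ, fix M => fix (subst σ M)
  | σ, choice k M N => choice k (subst σ M) (subst σ N)

/-- `M[N/x]`, where `x` is the outermost bound variable of `M`. -/
def inst (M N : Tm n) : Tm n :=
  subst (fun k => match k with
    | 0 => N
    | j + 1 => var j) M

/-- The numeral `SUCC^k 0`. -/
def num : ℕ → Tm n
  | 0 => zero
  | k + 1 => succ (num k)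

end Tm

/-- One-step weak head call-by-name reduction; the label lists the letter that is chosen, if any. -/
inductive Step {n : ℕ} : Tm n → List (Letter n) → Tm n → Prop
  | iteZero (M N : Tm n) : Step (.ite .zero M N) [] M
  | iteSucc (k : ℕ) (M N : Tm n) : Step (.ite (.succ (.num k)) M N) [] N
  | beta (M N : Tm n) : Step (.app (.lam M) N) [] (M.inst N)
  | unfold (M : Tm n) : Step (.fix M) [] (.app M (.fix M))
  | predZero : Step (.pred .zero) [] .zero
  | predSucc (M : Tm n) : Step (.pred (.succ M)) [] M
  | left (k : Fin n) (M N : Tm n) : Step (.choice k M N) [(k, false)] M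
  | right (k : Fin n) (M N : Tm n) : Step (.choice k M N) [(k, true)] N
  | iteCongr {M M' : Tm n} {l : List (Letter n)} (N P : Tm n) :
      Step M l M' → Step (.ite M N P) l (.ite M' N P)
  | appCongr {M M' : Tm n} {l : List (Letter n)} (N : Tm n) :
      Step M l M' → Step (.app M N) l (.app M' N)
  | predCongr {M M' : Tm n} {l : List (Letter n)} : Step M l M' → Step (.pred M) l (.pred M')
  | succCongr {M M' : Tm n} {l : List (Letter n)} : Step M l M' → Step (.succ M) l (.succ M')

/-- Reflexive transitive closure of `Step`, recording the sequence of letters chosen. -/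
inductive Red {n : ℕ} : Tm n → List (Letter n) → Tm n → Prop
  | refl (M : Tm n) : Red M [] M
  | head {M N P : Tm n} {l l' : List (Letter n)} : Step M l N → Red N l' P → Red M (l ++ l') P

/-- `w ∈ {0,1}*` is the sequence of (left/right) choices made by a reduction of `M` to the
numeral `i` whose weight is the monomial `μ`. -/
def Trajectory {n : ℕ} (M : Tm n) (i : ℕ) (μ : Mono n) (w : List Bool) : Prop :=
  ∃ l : List (Letter n), Red M l (.num i) ∧ w = l.map Prod.snd ∧ μ = fun a => l.count a

/-- The weights of all trajectories of `M` to the numeral `i`. -/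
def trajectoryWeights {n : ℕ} (M : Tm n) (i : ℕ) : Set (Mono n) :=
  {μ | ∃ w, Trajectory M i μ w}

/-! ## Simple types and typing derivations -/

inductive Ty : Type
  | bool : Ty
  | nat : Ty
  | arr : Ty → Ty → Ty

/-- Typed de Bruijn variables. -/
inductive Var : List Ty → Ty → Type
  | zero {Γ : List Ty} {A : Ty} : Var (A :: Γ) A
  | succ {Γ : List Ty} {A B : Ty} : Var Γ A → Var (B :: Γ) A

def Var.index : {Γ : List Ty} → {A : Ty} → Var Γ A → ℕ
  | _, _, .zero => 0
  | _, _, .succ v => v.index + 1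

/-- Typing derivations. Both numerals `0` and `1` are Booleans, and Booleans are integers. -/
inductive Typing {n : ℕ} : List Ty → Tm n → Ty → Type
  | zeroN {Γ : List Ty} : Typing Γ .zero .nat
  | zeroB {Γ : List Ty} : Typing Γ .zero .bool
  | oneB {Γ : List Ty} : Typing Γ (.succ .zero) .bool
  | cast {Γ : List Ty} {M : Tm n} : Typing Γ M .bool → Typing Γ M .nat
  | succ {Γ : List Ty} {M : Tm n} : Typing Γ M .nat → Typing Γ (.succ M) .nat
  | pred {Γ : List Ty} {M : Tm n} : Typing Γ M .nat → Typing Γ (.pred M) .nat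
  | var {Γ : List Ty} {A : Ty} (v : Var Γ A) : Typing Γ (.var v.index) A
  | lam {Γ : List Ty} {A B : Ty} {M : Tm n} : Typing (A :: Γ) M B → Typing Γ (.lam M) (.arr A B)
  | app {Γ : List Ty} {A B : Ty} {M N : Tm n} :
      Typing Γ M (.arr A B) → Typing Γ N A → Typing Γ (.app M N) B
  | ite {Γ : List Ty} {A : Ty} {M N P : Tm n} :
      Typing Γ M .nat → Typing Γ N A → Typing Γ P A → Typing Γ (.ite M N P) A
  | choice {Γ : List Ty} {A : Ty} {M N : Tm n} (k : Fin n) :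
      Typing Γ M A → Typing Γ N A → Typing Γ (.choice k M N) A
  | fix {Γ : List Ty} {A : Ty} {M : Tm n} : Typing Γ M (.arr A A) → Typing Γ (.fix M) A

/-! ## Intersection types -/

/-- The (non-idempotent) intersection types that refine a simple type: `0, 1` refine `bool`, the
natural numbers refine `nat`, and `(m, b)`, that is `m ⊸ b`, refines `A → B` when `m` is a finite
multiset of refinements of `A` and `b` refines `B`. -/
def Ty.Ref : Ty → Type
  | .bool => Fin 2
  | .nat => ℕ
  | .arr A B => Multiset A.Ref × B.Ref

/-- Intersection contexts that refine a simple context: a multiset for every variable. -/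
def Ctx : List Ty → Type
  | [] => PUnit
  | A :: Γ => Multiset A.Ref × Ctx Γ

/-- Contexts are added variable-wise; `0` assigns the empty multiset to every variable. -/
instance Ctx.instAddCommMonoid : (Γ : List Ty) → AddCommMonoid (Ctx Γ)
  | [] => inferInstanceAs (AddCommMonoid PUnit)
  | A :: Γ =>
    letI := Ctx.instAddCommMonoid Γ
    inferInstanceAs (AddCommMonoid (Multiset A.Ref × Ctx Γ))

/-- The context `v : [a]`. -/
def Ctx.single : {Γ : List Ty} → {A : Ty} → Var Γ A → A.Ref → Ctx Γ
  | _ :: _, _, .zero, a => (({a} : Multiset _), 0)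
  | _ :: _, _, .succ v, a => ((0 : Multiset _), Ctx.single v a)

/-- All atoms occurring in an intersection type are at most `p`. -/
def Ty.AtomsLe (p : ℕ) : (A : Ty) → A.Ref → Prop
  | .bool, c => Fin.val (n := 2) c ≤ p
  | .nat, k => Nat.le k p
  | .arr A B, (m, b) => (∀ c ∈ m, A.AtomsLe p c) ∧ B.AtomsLe p b

/-- In every arrow type `m ⊸ b` that occurs, `m` has at most `p` elements and contains no atom
larger than `p`. -/
def Ty.Bounded (p : ℕ) : (A : Ty) → A.Ref → Prop
  | .bool, _ => True
  | .nat, _ => True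
  | .arr A B, (m, b) =>
    m.card ≤ p ∧ (∀ c ∈ m, A.AtomsLe p c ∧ A.Bounded p c) ∧ B.Bounded p b

/-! ## The system `P`: one reduction at a time -/

/-- `PDer p Π y γ a μ`: there is a derivation of `γ ⊢ M : a` of weight `μ` in the system `P` (with
formal monomials as weights) that refines the simple typing derivation `Π` of `M`, uses the rule
for `Y` exactly `y` times and in which all types are bounded by `p`. In the rules for application
and `Y`, the list `args` collects, for each element of the multiset in the type of the function,
the context, type, weight and number of `Y`-rules of the corresponding derivation. -/
inductive PDer {n : ℕ} (p : ℕ) : {Γ : List Ty} → {M : Tm n} → {A : Ty} → Typing Γ M A →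
    ℕ → Ctx Γ → A.Ref → Mono n → Prop
  | zeroN {Γ : List Ty} : PDer p (.zeroN (Γ := Γ)) 0 0 (0 : ℕ) 0
  | zeroB {Γ : List Ty} : PDer p (.zeroB (Γ := Γ)) 0 0 (0 : Fin 2) 0
  | oneB {Γ : List Ty} : PDer p (.oneB (Γ := Γ)) 0 0 (1 : Fin 2) 0
  | cast {Γ : List Ty} {M : Tm n} {D : Typing Γ M .bool} {y : ℕ} {γ : Ctx Γ} {c : Fin 2}
      {μ : Mono n} : PDer p D y γ c μ → PDer p (.cast D) y γ (c : ℕ) μ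
  | succ {Γ : List Ty} {M : Tm n} {D : Typing Γ M .nat} {y : ℕ} {γ : Ctx Γ} {k : ℕ}
      {μ : Mono n} : PDer p D y γ k μ → PDer p (.succ D) y γ (k + 1 : ℕ) μ
  | pred {Γ : List Ty} {M : Tm n} {D : Typing Γ M .nat} {y : ℕ} {γ : Ctx Γ} {k : ℕ}
      {μ : Mono n} : PDer p D y γ k μ → PDer p (.pred D) y γ (k - 1 : ℕ) μ
  | var {Γ : List Ty} {A : Ty} (v : Var Γ A) (a : A.Ref) (ha : A.Bounded p a) :
      PDer p (.var v) 0 (Ctx.single v a) a 0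
  | lam {Γ : List Ty} {A B : Ty} {M : Tm n} {D : Typing (A :: Γ) M B} {y : ℕ} {γ : Ctx Γ}
      {m : Multiset A.Ref} {b : B.Ref} {μ : Mono n} (ha : (Ty.arr A B).Bounded p (m, b)) :
      PDer p D y (m, γ) b μ → PDer p (.lam D) y γ (m, b) μ
  | app {Γ : List Ty} {A B : Ty} {M N : Tm n} {D : Typing Γ M (.arr A B)} {E : Typing Γ N A}
      {y : ℕ} {γ : Ctx Γ} {b : B.Ref} {μ : Mono n} (args : List (Ctx Γ × A.Ref × Mono n × ℕ))
      (ha : B.Bounded p b) :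
      PDer p D y γ ((args.map (fun d => d.2.1) : Multiset A.Ref), b) μ →
      (∀ d ∈ args, PDer p E d.2.2.2 d.1 d.2.1 d.2.2.1) →
      PDer p (.app D E) (y + (args.map (fun d => d.2.2.2)).sum)
        (γ + (args.map (fun d => d.1)).sum) b (μ + (args.map (fun d => d.2.2.1)).sum)
  | iteZero {Γ : List Ty} {A : Ty} {M N P : Tm n} {D : Typing Γ M .nat} {E : Typing Γ N A}
      {F : Typing Γ P A} {y z : ℕ} {γ δ : Ctx Γ} {a : A.Ref} {μ ν : Mono n}
      (ha : A.Bounded p a) :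
      PDer p D y γ (0 : ℕ) μ → PDer p E z δ a ν →
      PDer p (.ite D E F) (y + z) (γ + δ) a (μ + ν)
  | iteSucc {Γ : List Ty} {A : Ty} {M N P : Tm n} {D : Typing Γ M .nat} {E : Typing Γ N A}
      {F : Typing Γ P A} {y z : ℕ} {γ δ : Ctx Γ} {a : A.Ref} {μ ν : Mono n} {k : ℕ}
      (ha : A.Bounded p a) :
      PDer p D y γ (k + 1 : ℕ) μ → PDer p F z δ a ν →
      PDer p (.ite D E F) (y + z) (γ + δ) a (μ + ν)
  | left {Γ : List Ty} {A : Ty} {M N : Tm n} {k : Fin n} {D : Typing Γ M A} {E : Typing Γ N A}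
      {y : ℕ} {γ : Ctx Γ} {a : A.Ref} {μ : Mono n} (ha : A.Bounded p a) :
      PDer p D y γ a μ → PDer p (.choice k D E) y γ a (μ + Pi.single (k, false) 1)
  | right {Γ : List Ty} {A : Ty} {M N : Tm n} {k : Fin n} {D : Typing Γ M A} {E : Typing Γ N A}
      {y : ℕ} {γ : Ctx Γ} {a : A.Ref} {μ : Mono n} (ha : A.Bounded p a) :
      PDer p E y γ a μ → PDer p (.choice k D E) y γ a (μ + Pi.single (k, true) 1)
  | fix {Γ : List Ty} {A : Ty} {M : Tm n} {D : Typing Γ M (.arr A A)}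
      {y : ℕ} {γ : Ctx Γ} {b : A.Ref} {μ : Mono n} (args : List (Ctx Γ × A.Ref × Mono n × ℕ))
      (ha : A.Bounded p b) :
      PDer p D y γ ((args.map (fun d => d.2.1) : Multiset A.Ref), b) μ →
      (∀ d ∈ args, PDer p (.fix D) d.2.2.2 d.1 d.2.1 d.2.2.1) →
      PDer p (.fix D) (y + (args.map (fun d => d.2.2.2)).sum + 1)
        (γ + (args.map (fun d => d.1)).sum) b (μ + (args.map (fun d => d.2.2.1)).sum)

/-! ## Minimal Newton polytopes

All-one polynomials are identified with their support, a set of monomials. Sums are then unions,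
products are pointwise sums of sets, and the polynomial `1` is the set `{0} = 0`. -/

/-- A monomial as a point of Euclidean space. -/
def Mono.toPoint {n : ℕ} (μ : Mono n) : Letter n → ℝ := fun a => (μ a : ℝ)

/-- The monomials that are vertices of the Newton polytope of `s`, i.e. of the convex hull of the
monomials of `s`. -/
def newtonVertices {n : ℕ} (s : Set (Mono n)) : Set (Mono n) :=
  {μ | μ.toPoint ∈ (convexHull ℝ (Mono.toPoint '' s)).extremePoints ℝ}

/-- `s_min`: the vertices of the minimal Newton polytope of `s`, that is, the vertices of the
Newton polytope that are minimal, among these vertices, for the pointwise order. -/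
def newtonMin {n : ℕ} (s : Set (Mono n)) : Set (Mono n) :=
  {μ | Minimal (· ∈ newtonVertices s) μ}

/-! ## The system `P_trop` -/

/-- Derivations of `P_trop` that refine a simple typing derivation. The index set of the
identity axiom is `I`. In the rules for application and `Y`, a family of typings of the function
is combined with typings of the argument: an element `(γ, args, b)` of `sel` combines the typing
`γ ⊢ [a₁, …, a_r] ⊸ b` of the function with the typings `δ_j ⊢ a_j` of the argument, where
`args = [(δ₁, a₁), …, (δ_r, a_r)]`. -/
inductive PTrop {n : ℕ} : {Γ : List Ty} → {M : Tm n} → {A : Ty} → Typing Γ M A → Type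
  | empty {Γ : List Ty} {M : Tm n} {A : Ty} (D : Typing Γ M A) : PTrop D
  | zeroN {Γ : List Ty} : PTrop (.zeroN (Γ := Γ))
  | zeroB {Γ : List Ty} : PTrop (.zeroB (Γ := Γ))
  | oneB {Γ : List Ty} : PTrop (.oneB (Γ := Γ))
  | cast {Γ : List Ty} {M : Tm n} {D : Typing Γ M .bool} : PTrop D → PTrop (.cast D)
  | succ {Γ : List Ty} {M : Tm n} {D : Typing Γ M .nat} : PTrop D → PTrop (.succ D)
  | pred {Γ : List Ty} {M : Tm n} {D : Typing Γ M .nat} : PTrop D → PTrop (.pred D)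
  | var {Γ : List Ty} {A : Ty} (v : Var Γ A) (I : Finset A.Ref) : PTrop (.var v)
  | lam {Γ : List Ty} {A B : Ty} {M : Tm n} {D : Typing (A :: Γ) M B} :
      PTrop D → PTrop (.lam D)
  | app {Γ : List Ty} {A B : Ty} {M N : Tm n} {D : Typing Γ M (.arr A B)} {E : Typing Γ N A}
      (sel : Set (Ctx Γ × Multiset (Ctx Γ × A.Ref) × B.Ref)) :
      PTrop D → PTrop E → PTrop (.app D E)
  | ite {Γ : List Ty} {A : Ty} {M N P : Tm n} {D : Typing Γ M .nat} {E : Typing Γ N A}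
      {F : Typing Γ P A} : PTrop D → PTrop E → PTrop F → PTrop (.ite D E F)
  | choice {Γ : List Ty} {A : Ty} {M N : Tm n} {k : Fin n} {D : Typing Γ M A}
      {E : Typing Γ N A} : PTrop D → PTrop E → PTrop (.choice k D E)
  | fix {Γ : List Ty} {A : Ty} {M : Tm n} {D : Typing Γ M (.arr A A)}
      (sel : Set (Ctx Γ × Multiset (Ctx Γ × A.Ref) × A.Ref)) :
      PTrop D → PTrop (.fix D) → PTrop (.fix D)

/-- The common clause of the rules for application and `Y`. Here `f` and `g` are the judgements of
the two premises, `mn` minimizes polynomials; first each product is minimized, then the equal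
typings are merged and the result is minimized. -/
def applyRule {n : ℕ} (mn : Set (Mono n) → Set (Mono n)) {Γ : List Ty} {A B : Ty}
    (sel : Set (Ctx Γ × Multiset (Ctx Γ × A.Ref) × B.Ref))
    (f : Ctx Γ → Multiset A.Ref × B.Ref → Set (Mono n)) (g : Ctx Γ → A.Ref → Set (Mono n))
    (γ : Ctx Γ) (b : B.Ref) : Set (Mono n) :=
  mn {μ | ∃ (γ₀ : Ctx Γ) (args : Multiset (Ctx Γ × A.Ref)), (γ₀, args, b) ∈ sel ∧
    γ = γ₀ + (args.map Prod.fst).sum ∧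
    μ ∈ mn (f γ₀ (args.map Prod.snd, b) + (args.map (fun d => g d.1 d.2)).sum)}

/-- The judgement proved by a derivation: `π.judg mn γ a` is the polynomial `s` of the typing
`γ ⊢^s M : a` in the conclusion of `π`, and is the zero polynomial `∅` if this typing does not
occur there. All polynomials are minimized by means of `mn`. -/
def PTrop.judg {n : ℕ} (mn : Set (Mono n) → Set (Mono n)) : {Γ : List Ty} → {M : Tm n} →
    {A : Ty} → {D : Typing Γ M A} → PTrop D → Ctx Γ → A.Ref → Set (Mono n)
  | _, _, _, _, .empty _, _, _ => ∅
  | _, _, _, _, .zeroN, γ, k => {μ | γ = 0 ∧ k = (0 : ℕ) ∧ μ = 0}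
  | _, _, _, _, .zeroB, γ, c => {μ | γ = 0 ∧ c = (0 : Fin 2) ∧ μ = 0}
  | _, _, _, _, .oneB, γ, c => {μ | γ = 0 ∧ c = (1 : Fin 2) ∧ μ = 0}
  | _, _, _, _, .cast π, γ, k => {μ | ∃ c : Fin 2, k = (c : ℕ) ∧ μ ∈ π.judg mn γ c}
  | _, _, _, _, .succ π, γ, k => {μ | ∃ j : ℕ, k = (j + 1 : ℕ) ∧ μ ∈ π.judg mn γ j}
  | _, _, _, _, .pred π, γ, k => mn {μ | ∃ j : ℕ, k = (j - 1 : ℕ) ∧ μ ∈ π.judg mn γ j}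
  | _, _, _, _, .var v I, γ, a => {μ | a ∈ I ∧ γ = Ctx.single v a ∧ μ = 0}
  | _, _, _, _, .lam π, γ, (m, b) => π.judg mn (m, γ) b
  | _, _, _, _, .app sel π ρ, γ, b =>
      applyRule mn sel (fun γ' a => π.judg mn γ' a) (fun γ' a => ρ.judg mn γ' a) γ b
  | _, _, _, _, .ite π ρ σ, γ, a =>
      mn {μ | ∃ γ₀ δ, γ = γ₀ + δ ∧
        (μ ∈ mn (π.judg mn γ₀ (0 : ℕ) + ρ.judg mn δ a) ∨
          ∃ k : ℕ, μ ∈ mn (π.judg mn γ₀ (k + 1 : ℕ) + σ.judg mn δ a))}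
  | _, _, _, _, .choice (k := k) π ρ, γ, a =>
      mn ((π.judg mn γ a + {Pi.single (k, false) 1}) ∪ (ρ.judg mn γ a + {Pi.single (k, true) 1}))
  | _, _, _, _, .fix sel π ρ, γ, b =>
      applyRule mn sel (fun γ' a => π.judg mn γ' a) (fun γ' a => ρ.judg mn γ' a) γ b

namespace PTrop

variable {n : ℕ} {M : Tm n} {D : Typing [] M .bool}

/-- The minimal polynomial `s` such that `π` proves `M : ⟨⊢^s i⟩`. -/
def poly (π : PTrop D) (i : Fin 2) : Set (Mono n) := π.judg newtonMin 0 i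

/-- The polynomial `traj^i(π)` of all trajectories explored by `π`, obtained from the same
derivation by dropping all minimizations. -/
def traj (π : PTrop D) (i : Fin 2) : Set (Mono n) := π.judg id 0 i

/-- `π` collects all `P`-derivations of `⊢ M : i` that use the rule for `Y` at most `m` times and
whose types are bounded by `p`. -/
def Collects (π : PTrop D) (i : Fin 2) (m p : ℕ) : Prop :=
  ∀ (y : ℕ) (μ : Mono n), y ≤ m → PDer p D y 0 i μ → μ ∈ π.traj i

end PTrop

/-- The derivation `π m p` is stable: the polynomial does not change when `m`, `p` increase. -/
def StableAt {n : ℕ} {M : Tm n} {D : Typing [] M .bool} (π : ℕ → ℕ → PTrop D) (i : Fin 2)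
    (m p : ℕ) : Prop :=
  ∀ m' p', m ≤ m' → p ≤ p' → (π m' p').poly i = (π m p).poly i

/-! ## Likelihoods, normal cones and selected trajectories -/

/-- `μ · x`, with `0 · ∞ = 0`. -/
noncomputable def dot {n : ℕ} (μ : Mono n) (x : Letter n → ℝ≥0∞) : ℝ≥0∞ :=
  ∑ a, (μ a : ℝ≥0∞) * x a

/-- The probability `q^μ` of a trajectory of weight `μ` when each letter `a` has probability
`q a`. -/
def prob {n : ℕ} (q : Letter n → Set.Icc (0 : ℝ) 1) (μ : Mono n) : ℝ :=
  ∏ a, (q a : ℝ) ^ μ a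

/-- `-ln r ∈ [0, ∞]` for `r ∈ [0, 1]`, with `-ln 0 = ∞`. -/
noncomputable def negLog (r : Set.Icc (0 : ℝ) 1) : ℝ≥0∞ :=
  if (r : ℝ) = 0 then ⊤ else ENNReal.ofReal (-Real.log r)

/-- `N(μ; s) = {x | x · μ = min_{ν ∈ s} x · ν}`. -/
def normalCone {n : ℕ} (μ : Mono n) (s : Set (Mono n)) : Set (Letter n → ℝ≥0∞) :=
  {x | IsLeast ((fun ν => dot ν x) '' s) (dot μ x)}

/-- `w` is a traceback of `s`: it assigns to each monomial `μ` of `s` the word of choices made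
during a reduction of `M` to `i` of weight `μ`. -/
def IsTraceback {n : ℕ} (M : Tm n) (i : ℕ) (s : Set (Mono n)) (w : Mono n → List Bool) : Prop :=
  ∀ μ ∈ s, Trajectory M i μ (w μ)

/-- A triple `(μ, w_μ, S)`. -/
structure Selected (n : ℕ) where
  weight : Mono n
  word : List Bool
  cone : Set (Letter n → ℝ≥0∞)

/-- The triples `(μ, w_μ, N(μ; s))`, for `μ` in `s`. -/
def selectedTrajs {n : ℕ} (s : Set (Mono n)) (w : Mono n → List Bool) : Set (Selected n) :=
  {e | ∃ μ ∈ s, e = ⟨μ, w μ, normalCone μ s⟩}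

/-- Under the assignment `q`, weight `μ` is the weight of a most likely element of `T`. -/
def MostLikely {n : ℕ} (q : Letter n → Set.Icc (0 : ℝ) 1) (T : Set (Mono n)) (μ : Mono n) : Prop :=
  μ ∈ T ∧ ∀ ν ∈ T, prob q ν ≤ prob q μ

/-- The pairs `(μ, w_μ)` of `sel` identify the most likely trajectories to `i` with weight in `T`:
all of them are words of actual reductions, with weight in `T`; under each assignment of
probabilities some of them is most likely in `T` (if `T` is not empty); and being most likely
among the selected ones is the same as being most likely in `T`. -/
structure IdentifiesMostLikely {n : ℕ} (M : Tm n) (i : ℕ) (sel : Set (Selected n))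
    (T : Set (Mono n)) : Prop where
  finite : sel.Finite
  sound : ∀ e ∈ sel, e.weight ∈ T ∧ Trajectory M i e.weight e.word
  exists_mostLikely : T.Nonempty → ∀ q, ∃ e ∈ sel, MostLikely q T e.weight
  mostLikely_iff : ∀ e ∈ sel, ∀ q,
    MostLikely q (Selected.weight '' sel) e.weight ↔ MostLikely q T e.weight

/-- The cones of `sel` are exactly the sets of `-ln` values of the parameters that minimize `μ`
across `T`, equivalently they give the probabilities for which `μ` is most likely in `T`. -/
structure IdentifiesParameters {n : ℕ} (sel : Set (Selected n)) (T : Set (Mono n)) : Prop where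
  cone_eq : ∀ e ∈ sel, e.cone = {x | e.weight ∈ T ∧ ∀ ν ∈ T, dot e.weight x ≤ dot ν x}
  negLog_mem_cone_iff : ∀ e ∈ sel, ∀ q : Letter n → Set.Icc (0 : ℝ) 1,
    (fun a => negLog (q a)) ∈ e.cone ↔ MostLikely q T e.weight

/-! ## Dominance of the minimal Newton polytope -/

namespace Mono

variable {n : ℕ}

/-! The whole argument is about one relation. `Dominates t s` says that `t ⊆ s` and that, at every
point `x` of `[0, ∞]^𝕏`, each monomial of `s` is matched by one of `t` with a dot product at most as
large. Since `-ln` turns probabilities into dot products and reverses the order, a finite `s`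
dominating `T` has the same most likely weights as `T`, and the normal cones of its members can be
computed in `T`. Both conclusions of the theorem therefore reduce to dominance
(`Dominates.identifiesMostLikely`, `Dominates.identifiesParameters`).

Taking `newtonMin` preserves dominance, even for infinite sets: by Dickson's lemma a functional with
nonnegative coefficients attains its minimum on any nonempty set of monomials, the minimizers span a
face of the Newton polytope, and a vertex of that face is a vertex of the polytope
(`exists_mem_newtonVertices_dot_le`). Dominance is also compatible with sums and products of
polynomials, so by induction on a derivation the minimized polynomial dominates the unminimized one
(`PTrop.dominates_judg`).

It remains to compare explored weights with weights of trajectories. The relation `Typing.sem`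
describes typings with weights, free of bounds and counters. Soundness is a realizability argument
(`Typing.realizes_of_sem`): a semantic typing of a closed Boolean term yields a reduction of the
same weight. Completeness is subject expansion (`Step.exists_typing`), which rests on an
anti-substitution lemma (`SubstClass.exists_subst`): typings are pulled back from the numeral along
the reduction, and then realized by a derivation of `P` for all large bounds.

Every trajectory weight is thus explored once the bounds are large. If the polynomial no longer
changes, it already dominates all trajectory weights (`StableAt.dominates`). -/

theorem exists_forall_le_of_monotone {α : Type*} [LinearOrder α] {f : Mono n → α}
    (hf : Monotone f) {s : Set (Mono n)} (hs : s.Nonempty) : ∃ μ ∈ s, ∀ ν ∈ s, f μ ≤ f ν := by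
  -- Dickson's lemma: every set of monomials is partially well-ordered, so no finiteness of `s` is
  -- needed.
  have h : (f '' s).IsPWO := (Set.isPWO_of_wellQuasiOrderedLE s).image_of_monotone hf
  obtain ⟨μ, hμ, e⟩ := h.isWF.min_mem (hs.image f)
  exact ⟨μ, hμ, fun ν hν => e ▸ h.isWF.min_le (hs.image f) ⟨ν, hν, rfl⟩⟩

theorem toPoint_injective : Function.Injective (toPoint (n := n)) := fun μ ν h => by
  funext a
  exact Nat.cast_injective (R := ℝ) (congrFun h a)

end Mono

theorem dot_mono {n : ℕ} {μ ν : Mono n} (h : μ ≤ ν) (x : Letter n → ℝ≥0∞) : dot μ x ≤ dot ν x :=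
  Finset.sum_le_sum fun a _ => by gcongr; exact h a

theorem dot_add {n : ℕ} (μ ν : Mono n) (x : Letter n → ℝ≥0∞) :
    dot (μ + ν) x = dot μ x + dot ν x := by
  simp [dot, add_mul, Finset.sum_add_distrib]

/-- The points of `s` that minimize `φ`. -/
def argminOn {E : Type*} (φ : E → ℝ) (s : Set E) : Set E := {x ∈ s | ∀ y ∈ s, φ x ≤ φ y}

/-- The hull of the minimizers is exactly the part of the hull of `s` where `φ` takes its minimal
value, and such a level set is a face. No closedness or finiteness of `s` is involved. -/
theorem isExtreme_convexHull_argminOn {E : Type*} [AddCommGroup E] [Module ℝ E]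
    (φ : E →ₗ[ℝ] ℝ) {s : Set E} (hs : (argminOn φ s).Nonempty) :
    IsExtreme ℝ (convexHull ℝ s) (convexHull ℝ (argminOn φ s)) := by
  obtain ⟨x₀, hx₀, hmin⟩ := hs
  have hge : ∀ y ∈ convexHull ℝ s, φ x₀ ≤ φ y := fun y hy =>
    (convexHull_min (s := s) (t := {y | φ x₀ ≤ φ y}) hmin
      (convex_halfSpace_ge φ.isLinear _)) hy
  have heq : ∀ y ∈ convexHull ℝ (argminOn φ s), φ y = φ x₀ := fun y hy =>
    (convexHull_min (s := argminOn φ s) (t := {y | φ y = φ x₀})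
      (fun z hz => le_antisymm (hz.2 _ hx₀) (hmin _ hz.1))
      (convex_hyperplane φ.isLinear _)) hy
  have hmem : ∀ y ∈ convexHull ℝ s, φ y = φ x₀ → y ∈ convexHull ℝ (argminOn φ s) := by
    intro y hy hφ
    -- A point of the hull is then a mixture of a point in the hull of the minimizers and a point
    -- strictly above the minimum. If its value is minimal, the second coefficient vanishes.
    have hu : s = argminOn φ s ∪ {z ∈ s | φ x₀ < φ z} := by
      ext z
      constructor
      · intro hz
        rcases (hmin z hz).eq_or_lt with h | h
        · exact Or.inl ⟨hz, fun w hw => h ▸ hmin w hw⟩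
        · exact Or.inr ⟨hz, h⟩
      · rintro (h | h)
        exacts [h.1, h.1]
    rcases Set.eq_empty_or_nonempty {z ∈ s | φ x₀ < φ z} with he | hne
    · rw [he, Set.union_empty] at hu
      rwa [← hu]
    rw [hu, convexHull_union (show (argminOn φ s).Nonempty from ⟨x₀, hx₀, hmin⟩) hne, mem_convexJoin] at hy
    obtain ⟨f, hf, g, hg, a, b, -, hb, hab, rfl⟩ := hy
    have hgt : φ x₀ < φ g := (convexHull_min (s := {z ∈ s | φ x₀ < φ z}) (t := {y | φ x₀ < φ y})
      (fun z hz => hz.2) (convex_halfSpace_gt φ.isLinear _)) hg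
    rw [map_add, map_smul, map_smul, heq f hf, smul_eq_mul, smul_eq_mul] at hφ
    have hb0 : b = 0 := by
      have : b * (φ g - φ x₀) = 0 := by linear_combination hφ - φ x₀ * hab
      rcases mul_eq_zero.1 this with h | h
      · exact h
      · linarith
    obtain rfl : a = 1 := by linarith
    simpa [hb0] using hf
  refine ⟨convexHull_mono fun z hz => hz.1, ?_⟩
  rintro x hx y hy z hz ⟨a, b, ha, hb, hab, rfl⟩
  refine hmem x hx (le_antisymm ?_ (hge x hx))
  have h := heq _ hz
  rw [map_add, map_smul, map_smul, smul_eq_mul, smul_eq_mul] at h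
  have h2 := hge y hy
  -- Both endpoints have value at least the minimum, and `x` has positive coefficient, so a strict
  -- excess at `x` would show at the interior point.
  by_contra hlt
  push Not at hlt
  have h3 := mul_lt_mul_of_pos_left hlt ha
  have h4 := mul_le_mul_of_nonneg_left h2 hb.le
  have h5 : a * φ x₀ + b * φ x₀ = φ x₀ := by rw [← add_mul, hab, one_mul]
  linarith

/-! ### Faces of Newton polytopes and existence of optimal vertices -/

section Vertices

variable {n : ℕ}

/-- The linear functional with coefficients `c`. -/
noncomputable def coeffFunctional (c : Letter n → NNReal) : (Letter n → ℝ) →ₗ[ℝ] ℝ :=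
  ∑ a, (c a : ℝ) • LinearMap.proj a

theorem coeffFunctional_apply (c : Letter n → NNReal) (v : Letter n → ℝ) :
    coeffFunctional c v = ∑ a, (c a : ℝ) * v a := by
  simp [coeffFunctional]

/-- Nonnegative coefficients make the functional monotone for divisibility, which is why the minimum
is attained. The face is given as a set `t` of monomials so that the construction can be iterated
inside it. -/
theorem exists_extreme_subset_argmin (c : Letter n → NNReal) {s : Set (Mono n)}
    (hs : s.Nonempty) :
    ∃ t ⊆ s, t.Nonempty ∧
      IsExtreme ℝ (convexHull ℝ (Mono.toPoint '' s)) (convexHull ℝ (Mono.toPoint '' t)) ∧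
      ∀ μ, μ ∈ t ↔ μ ∈ s ∧ ∀ ν ∈ s, coeffFunctional c μ.toPoint ≤ coeffFunctional c ν.toPoint := by
  have hmono : Monotone fun μ : Mono n => coeffFunctional c μ.toPoint := by
    intro μ ν h
    simp only [coeffFunctional_apply]
    refine Finset.sum_le_sum fun a _ => mul_le_mul_of_nonneg_left ?_ (c a).2
    exact Nat.cast_le.2 (h a)
  obtain ⟨μ, hμ, hmin⟩ := Mono.exists_forall_le_of_monotone hmono hs
  refine ⟨{μ ∈ s | ∀ ν ∈ s, coeffFunctional c μ.toPoint ≤ coeffFunctional c ν.toPoint},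
    fun _ h => h.1, ⟨μ, hμ, hmin⟩, ?_, fun _ => Iff.rfl⟩
  have e : Mono.toPoint ''
      {μ ∈ s | ∀ ν ∈ s, coeffFunctional c μ.toPoint ≤ coeffFunctional c ν.toPoint} =
      argminOn (coeffFunctional c) (Mono.toPoint '' s) := by
    ext y
    constructor
    · rintro ⟨ν, ⟨h, h'⟩, rfl⟩
      exact ⟨⟨ν, h, rfl⟩, by rintro _ ⟨ξ, hξ, rfl⟩; exact h' ξ hξ⟩
    · rintro ⟨⟨ν, h, rfl⟩, h'⟩
      exact ⟨ν, ⟨h, fun ξ hξ => h' _ ⟨ξ, hξ, rfl⟩⟩, rfl⟩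
  rw [e]
  exact isExtreme_convexHull_argminOn _ (e ▸ ⟨_, μ, ⟨hμ, hmin⟩, rfl⟩)

theorem newtonVertices_subset (s : Set (Mono n)) : newtonVertices s ⊆ s := fun μ h => by
  obtain ⟨ν, hν, e⟩ := extremePoints_convexHull_subset h
  exact Mono.toPoint_injective e ▸ hν

/-- Minimizing the exponents of the letters one after another gives a chain of faces. On the last
face all exponents are fixed, so it is a single monomial, hence a vertex. -/
theorem newtonVertices_nonempty {s : Set (Mono n)} (hs : s.Nonempty) :
    (newtonVertices s).Nonempty := by
  have key : ∀ S : Finset (Letter n), ∃ t ⊆ s, t.Nonempty ∧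
      IsExtreme ℝ (convexHull ℝ (Mono.toPoint '' s)) (convexHull ℝ (Mono.toPoint '' t)) ∧
      ∀ a ∈ S, ∀ μ ∈ t, ∀ ν ∈ t, μ a = ν a := by
    intro S
    induction S using Finset.induction_on with
    | empty => exact ⟨s, subset_rfl, hs, IsExtreme.rfl, by simp⟩
    | insert a S _ ih =>
      obtain ⟨t, hts, ht, hext, hS⟩ := ih
      obtain ⟨u, hut, hu, hext', hmin⟩ := exists_extreme_subset_argmin (Pi.single a 1) ht
      refine ⟨u, hut.trans hts, hu, hext.trans hext', fun b hb μ hμ ν hν => ?_⟩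
      rcases Finset.mem_insert.1 hb with rfl | hb
      · have key : ∀ ξ : Mono n, coeffFunctional (Pi.single b 1) ξ.toPoint = ξ b := by
          intro ξ
          rw [coeffFunctional_apply, Finset.sum_eq_single b]
          · simp [Mono.toPoint]
          · intro c _ hc
            simp [Pi.single_eq_of_ne hc]
          · simp
        have h1 := ((hmin μ).1 hμ).2 ν (hut hν)
        have h2 := ((hmin ν).1 hν).2 μ (hut hμ)
        rw [key, key] at h1 h2
        exact_mod_cast le_antisymm h1 h2
      · exact hS b hb μ (hut hμ) ν (hut hν)
  obtain ⟨t, -, ⟨μ, hμ⟩, hext, h⟩ := key Finset.univ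
  have ht : t = {μ} := Set.eq_singleton_iff_unique_mem.2
    ⟨hμ, fun ν hν => funext fun a => h a (Finset.mem_univ a) ν hν μ hμ⟩
  rw [ht, Set.image_singleton, convexHull_singleton, isExtreme_singleton] at hext
  exact ⟨μ, hext⟩

theorem IsExtreme.newtonVertices_subset {s t : Set (Mono n)}
    (h : IsExtreme ℝ (convexHull ℝ (Mono.toPoint '' s)) (convexHull ℝ (Mono.toPoint '' t))) :
    newtonVertices t ⊆ newtonVertices s := fun _ hμ => h.extremePoints_subset_extremePoints hμ

/-- Infinite coordinates of `x` prevent a single real functional from sufficing. Two nested faces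
are taken: first the letters of infinite cost are excluded, then the finite cost is minimized. -/
theorem exists_mem_newtonVertices_dot_le {s : Set (Mono n)} (x : Letter n → ℝ≥0∞) {ν : Mono n}
    (hν : ν ∈ s) : ∃ μ ∈ newtonVertices s, dot μ x ≤ dot ν x := by
  by_cases htop : dot ν x = ⊤
  · obtain ⟨μ, hμ⟩ := newtonVertices_nonempty ⟨ν, hν⟩
    exact ⟨μ, hμ, htop ▸ le_top⟩
  have hν0 : ∀ a, x a = ⊤ → ν a = 0 := by
    intro a ha
    by_contra h0
    refine htop (ENNReal.sum_eq_top.2 ⟨a, Finset.mem_univ a, ?_⟩)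
    rw [ha, ENNReal.mul_top (by exact_mod_cast h0)]
  -- The functional counts the letters of infinite cost. It vanishes at `ν`, so `t` consists of the
  -- monomials of `s` that avoid these letters.
  obtain ⟨t, hts, htne, hext, hmin⟩ :=
    exists_extreme_subset_argmin (fun a => if x a = ⊤ then 1 else 0) ⟨ν, hν⟩
  have hz : coeffFunctional (fun a => if x a = ⊤ then 1 else 0) ν.toPoint = 0 := by
    rw [coeffFunctional_apply]
    refine Finset.sum_eq_zero fun b _ => ?_
    by_cases hb : x b = ⊤
    · simp [Mono.toPoint, hν0 b hb]
    · simp [hb]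
  have hνt : ν ∈ t := (hmin ν).2 ⟨hν, fun ξ _ => by
    rw [hz, coeffFunctional_apply]
    exact Finset.sum_nonneg fun b _ => mul_nonneg (NNReal.coe_nonneg _) (Nat.cast_nonneg _)⟩
  have ht0 : ∀ μ ∈ t, ∀ a, x a = ⊤ → μ a = 0 := by
    intro μ hμ a ha
    have h := ((hmin μ).1 hμ).2 ν hν
    rw [hz] at h
    rw [coeffFunctional_apply] at h
    have h1 := Finset.single_le_sum
      (f := fun b => (((if x b = ⊤ then 1 else 0 : NNReal)) : ℝ) * μ.toPoint b)
      (fun b _ => mul_nonneg (NNReal.coe_nonneg _) (Nat.cast_nonneg _)) (Finset.mem_univ a)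
    simp only [ha, if_true, NNReal.coe_one, one_mul] at h1
    have h2 : ((μ a : ℕ) : ℝ) ≤ 0 := h1.trans h
    exact_mod_cast le_antisymm h2 (Nat.cast_nonneg _)
  -- `toNNReal` sends `∞` to `0`, which is harmless on `t` because the corresponding exponents are
  -- `0` there.
  obtain ⟨u, hut, hune, hext', hmin'⟩ := exists_extreme_subset_argmin (fun a => (x a).toNNReal) htne
  obtain ⟨μ, hμ⟩ := newtonVertices_nonempty hune
  refine ⟨μ, (hext.trans hext').newtonVertices_subset hμ, ?_⟩
  have hμu := _root_.newtonVertices_subset u hμ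
  have hdot : ∀ ξ : Mono n, (∀ a, x a = ⊤ → ξ a = 0) →
      dot ξ x = ENNReal.ofReal (coeffFunctional (fun a => (x a).toNNReal) ξ.toPoint) := by
    intro ξ hξ
    have hnonneg : ∀ a ∈ Finset.univ, 0 ≤ ((x a).toNNReal : ℝ) * ξ.toPoint a := fun a _ =>
      mul_nonneg (NNReal.coe_nonneg _) (Nat.cast_nonneg _)
    rw [coeffFunctional_apply, ENNReal.ofReal_sum_of_nonneg hnonneg]
    refine Finset.sum_congr rfl fun a _ => ?_
    by_cases ha : x a = ⊤
    · simp [hξ a ha, Mono.toPoint]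
    · rw [mul_comm, Mono.toPoint, ENNReal.ofReal_mul (NNReal.coe_nonneg _), ENNReal.ofReal_natCast]
      congr 1
      exact (ENNReal.ofReal_toReal ha).symm
  rw [hdot μ (ht0 μ (hut hμu)), hdot ν hν0]
  exact ENNReal.ofReal_le_ofReal (((hmin' μ).1 hμu).2 ν hνt)

theorem newtonMin_subset (s : Set (Mono n)) : newtonMin s ⊆ s := fun _ h =>
  newtonVertices_subset s h.prop

/-- Minimal elements form an antichain, and antichains of monomials are finite by Dickson's lemma,
whatever the size of `s`. -/
theorem newtonMin_finite (s : Set (Mono n)) : (newtonMin s).Finite :=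
  WellQuasiOrderedLE.finite_of_isAntichain (setOfPred_minimal_antichain _)

theorem exists_mem_newtonMin_dot_le {s : Set (Mono n)} (x : Letter n → ℝ≥0∞) {ν : Mono n}
    (hν : ν ∈ s) : ∃ μ ∈ newtonMin s, dot μ x ≤ dot ν x := by
  obtain ⟨μ, hμ, hle⟩ := exists_mem_newtonVertices_dot_le x hν
  obtain ⟨ξ, hξ, hmin⟩ := exists_minimal_le_of_wellFoundedLT (· ∈ newtonVertices s) μ hμ
  exact ⟨ξ, hmin, (dot_mono hξ x).trans hle⟩

end Vertices

/-! ## Tropical equivalence -/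

/-- `t` is a part of `s` with the same tropical evaluations. -/
structure Dominates {n : ℕ} (t s : Set (Mono n)) : Prop where
  subset : t ⊆ s
  exists_le : ∀ x : Letter n → ℝ≥0∞, ∀ ν ∈ s, ∃ μ ∈ t, dot μ x ≤ dot ν x

namespace Dominates

variable {n : ℕ} {r s t s' t' : Set (Mono n)}

protected theorem refl (s : Set (Mono n)) : Dominates s s :=
  ⟨subset_rfl, fun _ ν h => ⟨ν, h, le_rfl⟩⟩

protected theorem trans (h : Dominates r s) (h' : Dominates s t) : Dominates r t :=
  ⟨h.subset.trans h'.subset, fun x ν hν => by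
    obtain ⟨μ, hμ, hle⟩ := h'.exists_le x ν hν
    obtain ⟨ξ, hξ, hle'⟩ := h.exists_le x μ hμ
    exact ⟨ξ, hξ, hle'.trans hle⟩⟩

theorem newtonMin (h : Dominates t s) : Dominates (newtonMin t) s :=
  Dominates.trans ⟨newtonMin_subset t, fun x _ hν => exists_mem_newtonMin_dot_le x hν⟩ h

/-- The dot product is additive in the monomial, so dominating factors can be chosen independently.
-/
theorem add (h : Dominates t s) (h' : Dominates t' s') : Dominates (t + t') (s + s') := by
  refine ⟨Set.add_subset_add h.subset h'.subset, ?_⟩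
  rintro x _ ⟨ν, hν, ν', hν', rfl⟩
  obtain ⟨μ, hμ, hle⟩ := h.exists_le x ν hν
  obtain ⟨μ', hμ', hle'⟩ := h'.exists_le x ν' hν'
  refine ⟨μ + μ', Set.add_mem_add hμ hμ', ?_⟩
  simp only [dot_add]
  exact add_le_add hle hle'

theorem union (h : Dominates t s) (h' : Dominates t' s') : Dominates (t ∪ t') (s ∪ s') := by
  refine ⟨Set.union_subset_union h.subset h'.subset, ?_⟩
  rintro x ν (hν | hν)
  · obtain ⟨μ, hμ, hle⟩ := h.exists_le x ν hν
    exact ⟨μ, Or.inl hμ, hle⟩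
  · obtain ⟨μ, hμ, hle⟩ := h'.exists_le x ν hν
    exact ⟨μ, Or.inr hμ, hle⟩

theorem iUnion {ι : Sort*} {f g : ι → Set (Mono n)} (h : ∀ i, Dominates (f i) (g i)) :
    Dominates {μ | ∃ i, μ ∈ f i} {μ | ∃ i, μ ∈ g i} := by
  refine ⟨fun μ ⟨i, hi⟩ => ⟨i, (h i).subset hi⟩, ?_⟩
  rintro x ν ⟨i, hν⟩
  obtain ⟨μ, hμ, hle⟩ := (h i).exists_le x ν hν
  exact ⟨μ, ⟨i, hμ⟩, hle⟩

theorem and {p : Prop} (h : Dominates t s) : Dominates {μ | p ∧ μ ∈ t} {μ | p ∧ μ ∈ s} := by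
  refine ⟨fun μ hμ => ⟨hμ.1, h.subset hμ.2⟩, ?_⟩
  rintro x ν ⟨hp, hν⟩
  obtain ⟨μ, hμ, hle⟩ := h.exists_le x ν hν
  exact ⟨μ, ⟨hp, hμ⟩, hle⟩

theorem multiset_sum {α : Type*} {f g : α → Set (Mono n)} (h : ∀ a, Dominates (f a) (g a))
    (m : Multiset α) : Dominates (m.map f).sum (m.map g).sum := by
  induction m using Multiset.induction_on with
  | empty => exact .refl _
  | cons a m ih =>
    rw [Multiset.map_cons, Multiset.map_cons, Multiset.sum_cons, Multiset.sum_cons]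
    exact (h a).add ih

theorem applyRule {Γ : List Ty} {A B : Ty}
    (sel : Set (Ctx Γ × Multiset (Ctx Γ × A.Ref) × B.Ref))
    {f f' : Ctx Γ → Multiset A.Ref × B.Ref → Set (Mono n)} {g g' : Ctx Γ → A.Ref → Set (Mono n)}
    (hf : ∀ γ a, Dominates (f γ a) (f' γ a)) (hg : ∀ γ a, Dominates (g γ a) (g' γ a))
    (γ : Ctx Γ) (b : B.Ref) :
    Dominates (applyRule _root_.newtonMin sel f g γ b) (applyRule id sel f' g' γ b) :=
  (iUnion fun _ => iUnion fun _ => and (and (newtonMin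
    ((hf _ _).add (multiset_sum (fun _ => hg _ _) _))))).newtonMin

end Dominates

/-- The same derivation is evaluated with and without minimization. Each rule is built from unions
and products, which preserve dominance, and each intermediate `newtonMin` preserves it too. -/
theorem PTrop.dominates_judg {n : ℕ} {Γ : List Ty} {M : Tm n} {A : Ty} {D : Typing Γ M A}
    (π : PTrop D) (γ : Ctx Γ) (a : A.Ref) :
    Dominates (π.judg newtonMin γ a) (π.judg id γ a) := by
  induction π with
  | empty => exact .refl _
  | zeroN => exact .refl _
  | zeroB => exact .refl _
  | oneB => exact .refl _
  | cast π ih => exact .iUnion fun c => .and (ih γ c)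
  | succ π ih => exact .iUnion fun c => .and (ih γ c)
  | pred π ih => exact (Dominates.iUnion fun c => .and (ih γ c)).newtonMin
  | var => exact .refl _
  | lam π ih => exact ih _ _
  | app sel π ρ ih ih' => exact .applyRule sel ih ih' γ a
  | ite π ρ σ ih ih' ih'' =>
    exact (Dominates.iUnion fun _ => .iUnion fun _ => .and (.union ((ih _ _).add (ih' _ _)).newtonMin
      (.iUnion fun _ => ((ih _ _).add (ih'' _ _)).newtonMin))).newtonMin
  | choice π ρ ih ih' =>
    exact (((ih γ a).add (.refl _)).union ((ih' γ a).add (.refl _))).newtonMin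
  | fix sel π ρ ih ih' => exact .applyRule sel ih ih' γ a

/-- For a Boolean in the empty context, the last rule is either an axiom, which contributes at most
the monomial `0`, or a rule that ends with a minimization. -/
theorem PTrop.finite_poly {n : ℕ} {M : Tm n} {D : Typing [] M .bool} (π : PTrop D) (i : Fin 2) :
    (π.poly i).Finite := by
  have hsingle : ∀ p : Prop, ∀ q : Prop, {μ : Mono n | p ∧ q ∧ μ = 0}.Finite := fun p q =>
    (Set.finite_singleton 0).subset fun μ h => h.2.2
  cases π with
  | empty => exact Set.finite_empty
  | zeroB => exact hsingle _ _
  | oneB => exact hsingle _ _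
  | var v => cases v
  | app => exact newtonMin_finite _
  | ite => exact newtonMin_finite _
  | choice => exact newtonMin_finite _
  | fix => exact newtonMin_finite _

/-! ## Likelihoods -/

/-- `exp (-x)`, with `exp (-∞) = 0`. -/
noncomputable def expNeg (x : ℝ≥0∞) : ℝ := if x = ⊤ then 0 else Real.exp (-x.toReal)

theorem expNeg_le_expNeg {x y : ℝ≥0∞} : expNeg x ≤ expNeg y ↔ y ≤ x := by
  unfold expNeg
  by_cases hx : x = ⊤ <;> by_cases hy : y = ⊤
  · simp [hx, hy]
  · simp [hx, hy, Real.exp_nonneg]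
  · simp [hx, hy, Real.exp_pos]
  · simp [hx, hy, ENNReal.toReal_le_toReal hy hx]

theorem expNeg_zero : expNeg 0 = 1 := by simp [expNeg]

theorem expNeg_add (x y : ℝ≥0∞) : expNeg (x + y) = expNeg x * expNeg y := by
  unfold expNeg
  by_cases hx : x = ⊤
  · simp [hx]
  by_cases hy : y = ⊤
  · simp [hy]
  · simp [hx, hy, ENNReal.toReal_add hx hy, Real.exp_add, mul_comm]

/-- The convention `0 · ∞ = 0` corresponds here to `0 ^ 0 = 1`, so letters of probability zero need
no separate treatment. -/
theorem expNeg_natCast_mul (k : ℕ) (x : ℝ≥0∞) : expNeg (k * x) = expNeg x ^ k := by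
  induction k with
  | zero => simp [expNeg_zero]
  | succ k ih => rw [Nat.cast_succ, add_mul, one_mul, expNeg_add, ih, pow_succ]

theorem expNeg_sum {ι : Type*} (s : Finset ι) (f : ι → ℝ≥0∞) :
    expNeg (∑ i ∈ s, f i) = ∏ i ∈ s, expNeg (f i) := by
  classical
  induction s using Finset.induction_on with
  | empty => simp [expNeg_zero]
  | insert a s ha ih => rw [Finset.sum_insert ha, Finset.prod_insert ha, expNeg_add, ih]

theorem expNeg_negLog (r : Set.Icc (0 : ℝ) 1) : expNeg (negLog r) = r := by
  unfold expNeg negLog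
  by_cases hr : (r : ℝ) = 0
  · simp [hr]
  · have hpos : (0 : ℝ) < r := lt_of_le_of_ne r.2.1 (Ne.symm hr)
    rw [if_neg hr, if_neg ENNReal.ofReal_ne_top,
      ENNReal.toReal_ofReal (neg_nonneg.2 (Real.log_nonpos r.2.1 r.2.2)), neg_neg,
      Real.exp_log hpos]

theorem prob_eq_expNeg_dot {n : ℕ} (q : Letter n → Set.Icc (0 : ℝ) 1) (μ : Mono n) :
    prob q μ = expNeg (dot μ fun a => negLog (q a)) := by
  simp only [dot, prob, expNeg_sum, expNeg_natCast_mul, expNeg_negLog]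

theorem prob_le_prob {n : ℕ} (q : Letter n → Set.Icc (0 : ℝ) 1) (μ ν : Mono n) :
    prob q ν ≤ prob q μ ↔ dot μ (fun a => negLog (q a)) ≤ dot ν fun a => negLog (q a) := by
  rw [prob_eq_expNeg_dot, prob_eq_expNeg_dot, expNeg_le_expNeg]

namespace Dominates

variable {n : ℕ} {s T : Set (Mono n)}

/-- This equivalence makes both optimality and normal cones transfer between `s` and `T`. -/
theorem forall_le_iff (h : Dominates s T) (x : Letter n → ℝ≥0∞) (μ : Mono n) :
    (∀ ν ∈ s, dot μ x ≤ dot ν x) ↔ ∀ ν ∈ T, dot μ x ≤ dot ν x := by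
  refine ⟨fun hs ν hν => ?_, fun hT ν hν => hT ν (h.subset hν)⟩
  obtain ⟨ξ, hξ, hle⟩ := h.exists_le x ν hν
  exact (hs ξ hξ).trans hle

theorem mostLikely_iff (h : Dominates s T) {μ : Mono n} (hμ : μ ∈ s)
    (q : Letter n → Set.Icc (0 : ℝ) 1) : MostLikely q s μ ↔ MostLikely q T μ := by
  simp only [MostLikely, prob_le_prob, hμ, h.subset hμ, true_and]
  exact h.forall_le_iff _ μ

theorem normalCone_eq (h : Dominates s T) {μ : Mono n} (hμ : μ ∈ s) :
    normalCone μ s = {x | μ ∈ T ∧ ∀ ν ∈ T, dot μ x ≤ dot ν x} := by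
  ext x
  refine Iff.trans ?_ (and_congr (iff_of_true hμ (h.subset hμ)) (h.forall_le_iff x μ))
  constructor
  · rintro ⟨-, hl⟩
    exact ⟨hμ, fun ν hν => hl ⟨ν, hν, rfl⟩⟩
  · rintro ⟨-, hl⟩
    exact ⟨⟨μ, hμ, rfl⟩, by rintro _ ⟨ν, hν, rfl⟩; exact hl ν hν⟩

theorem identifiesMostLikely (h : Dominates s T) (hfin : s.Finite) {M : Tm n} {i : ℕ}
    {w : Mono n → List Bool} (hw : IsTraceback M i s w) :
    IdentifiesMostLikely M i (selectedTrajs s w) T where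
  finite := (hfin.image fun μ => (⟨μ, w μ, normalCone μ s⟩ : Selected n)).subset (by
    rintro _ ⟨μ, hμ, rfl⟩
    exact ⟨μ, hμ, rfl⟩)
  sound := by
    rintro _ ⟨μ, hμ, rfl⟩
    exact ⟨h.subset hμ, hw μ hμ⟩
  exists_mostLikely := by
    rintro ⟨ν, hν⟩ q
    obtain ⟨μ₀, hμ₀, -⟩ := h.exists_le 0 ν hν
    obtain ⟨μ, hμ, hmax⟩ := Set.exists_max_image s (prob q) hfin ⟨μ₀, hμ₀⟩
    exact ⟨_, ⟨μ, hμ, rfl⟩, (h.mostLikely_iff hμ q).1 ⟨hμ, hmax⟩⟩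
  mostLikely_iff := by
    rintro _ ⟨μ, hμ, rfl⟩ q
    have e : Selected.weight '' selectedTrajs s w = s := by
      ext ν
      constructor
      · rintro ⟨_, ⟨ξ, hξ, rfl⟩, rfl⟩
        exact hξ
      · exact fun hν => ⟨_, ⟨ν, hν, rfl⟩, rfl⟩
    rw [e]
    exact h.mostLikely_iff hμ q

theorem identifiesParameters (h : Dominates s T) (w : Mono n → List Bool) :
    IdentifiesParameters (selectedTrajs s w) T where
  cone_eq := by
    rintro _ ⟨μ, hμ, rfl⟩
    exact h.normalCone_eq hμ
  negLog_mem_cone_iff := by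
    rintro _ ⟨μ, hμ, rfl⟩ q
    show _ ∈ normalCone μ s ↔ _
    rw [h.normalCone_eq hμ]
    simp only [MostLikely, prob_le_prob, Set.mem_ofPred_eq]

end Dominates

/-! ## Weighted multisets -/

/-- `Bag R m w`: the elements `a` of the multiset `m` have weights related to them by `R`, whose sum
is `w`. -/
def Bag {α W : Type*} [AddCommMonoid W] (R : α → W → Prop) (m : Multiset α) (w : W) : Prop :=
  ∃ l : List (α × W), m = (l.map Prod.fst : Multiset α) ∧ w = (l.map Prod.snd).sum ∧
    ∀ d ∈ l, R d.1 d.2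

namespace Bag

variable {α W : Type*} [AddCommMonoid W] {R S : α → W → Prop}

theorem mono (h : ∀ a w, R a w → S a w) {m : Multiset α} {w : W} : Bag R m w → Bag S m w := by
  rintro ⟨l, hm, hw, hl⟩
  exact ⟨l, hm, hw, fun d hd => h _ _ (hl d hd)⟩

theorem zero : Bag R 0 0 := ⟨[], rfl, rfl, by simp⟩

theorem cons {a : α} {m : Multiset α} {v w : W} (ha : R a v) :
    Bag R m w → Bag R (a ::ₘ m) (v + w) := by
  rintro ⟨l, rfl, rfl, hl⟩
  refine ⟨(a, v) :: l, rfl, rfl, ?_⟩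
  rintro d (_ | ⟨_, hd⟩)
  exacts [ha, hl d hd]

theorem eq_zero {w : W} (h : Bag R 0 w) : w = 0 := by
  obtain ⟨l, hm, rfl, -⟩ := h
  cases l with
  | nil => rfl
  | cons d l => exact absurd hm.symm (Multiset.cons_ne_zero (a := d.1) (m := (l.map Prod.fst : Multiset α)))

/-- The multiset does not determine the order of the list of weighted elements, so an occurrence of
`a` is located and removed from it. -/
theorem exists_of_cons {a : α} {m : Multiset α} {w : W} (h : Bag R (a ::ₘ m) w) :
    ∃ v w', w = v + w' ∧ R a v ∧ Bag R m w' := by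
  obtain ⟨l, hm, rfl, hl⟩ := h
  have ha : a ∈ l.map Prod.fst := by
    rw [← Multiset.mem_coe, ← hm]
    exact Multiset.mem_cons_self a m
  obtain ⟨⟨a, v⟩, hd, rfl⟩ := List.mem_map.1 ha
  obtain ⟨l₁, l₂, rfl⟩ := List.append_of_mem hd
  refine ⟨v, ((l₁ ++ l₂).map Prod.snd).sum, ?_, hl _ hd, l₁ ++ l₂, ?_, rfl, fun d hd' => hl d ?_⟩
  · simp only [List.map_append, List.map_cons, List.sum_append, List.sum_cons]
    exact add_left_comm _ _ _
  · rw [List.map_append, List.map_cons, Multiset.coe_eq_coe.2 List.perm_middle,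
      ← Multiset.cons_coe] at hm
    rw [List.map_append]
    exact (Multiset.cons_inj_right a).1 hm
  · rcases List.mem_append.1 hd' with h | h
    · exact List.mem_append_left _ h
    · exact List.mem_append_right _ (List.mem_cons_of_mem _ h)

theorem add {m m' : Multiset α} {w w' : W} : Bag R m w → Bag R m' w' →
    Bag R (m + m') (w + w') := by
  rintro ⟨l, rfl, rfl, hl⟩ ⟨l', rfl, rfl, hl'⟩
  refine ⟨l ++ l', by simp, by simp, fun d hd => ?_⟩
  rcases List.mem_append.1 hd with h | h
  exacts [hl d h, hl' d h]

theorem exists_of_add {m m' : Multiset α} {w : W} (h : Bag R (m + m') w) :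
    ∃ v v', w = v + v' ∧ Bag R m v ∧ Bag R m' v' := by
  induction m using Multiset.induction_on generalizing w with
  | empty => exact ⟨0, w, (zero_add w).symm, zero, by rwa [zero_add] at h⟩
  | cons a m ih =>
    rw [Multiset.cons_add] at h
    obtain ⟨v, w', rfl, ha, h'⟩ := exists_of_cons h
    obtain ⟨u, u', rfl, hu, hu'⟩ := ih h'
    exact ⟨v + u, u', (add_assoc _ _ _).symm, cons ha hu, hu'⟩

theorem single {a : α} {w : W} (h : R a w) : Bag R {a} w := by
  simpa using cons h zero

theorem of_single {a : α} {w : W} (h : Bag R {a} w) : R a w := by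
  obtain ⟨v, w', rfl, ha, h'⟩ := exists_of_cons (m := 0) h
  rwa [h'.eq_zero, add_zero]

end Bag

/-- The pointwise extension of `Bag` to contexts, for a relation given for each variable. -/
def CtxBag {W : Type*} [AddCommMonoid W] : (Γ : List Ty) →
    (∀ {A : Ty}, Var Γ A → A.Ref → W → Prop) → Ctx Γ → W → Prop
  | [], _, _, w => w = 0
  | _ :: Γ, R, (m, γ), w => ∃ v v', w = v + v' ∧ Bag (R .zero) m v ∧
      CtxBag Γ (fun x => R (.succ x)) γ v'

namespace CtxBag

variable {W : Type*} [AddCommMonoid W]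

theorem zero : ∀ {Γ : List Ty} {R : ∀ {A : Ty}, Var Γ A → A.Ref → W → Prop}, CtxBag Γ R 0 0
  | [], _ => rfl
  | _ :: _, _ => ⟨0, 0, (add_zero _).symm, Bag.zero, CtxBag.zero⟩

theorem eq_zero : ∀ {Γ : List Ty} {R : ∀ {A : Ty}, Var Γ A → A.Ref → W → Prop} {w : W},
    CtxBag Γ R 0 w → w = 0
  | [], _, _, h => h
  | _ :: _, _, _, ⟨_, _, e, h, h'⟩ => by rw [e, Bag.eq_zero h, eq_zero h', add_zero]

theorem add : ∀ {Γ : List Ty} {R : ∀ {A : Ty}, Var Γ A → A.Ref → W → Prop} {γ γ' : Ctx Γ}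
    {w w' : W}, CtxBag Γ R γ w → CtxBag Γ R γ' w' → CtxBag Γ R (γ + γ') (w + w')
  | [], _, _, _, _, _, h, h' => by
    show _ + _ = (0 : W)
    rw [show _ = (0 : W) from h, show _ = (0 : W) from h', add_zero]
  | _ :: _, _, (_, _), (_, _), _, _, ⟨v, v', e, h, h'⟩, ⟨u, u', e', k, k'⟩ =>
    ⟨v + u, v' + u', by rw [e, e', add_add_add_comm], h.add k, h'.add k'⟩

theorem exists_of_add : ∀ {Γ : List Ty} {R : ∀ {A : Ty}, Var Γ A → A.Ref → W → Prop}
    {γ γ' : Ctx Γ} {w : W}, CtxBag Γ R (γ + γ') w →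
      ∃ v v', w = v + v' ∧ CtxBag Γ R γ v ∧ CtxBag Γ R γ' v'
  | [], _, _, _, _, h => ⟨0, 0, by rw [show _ = (0 : W) from h, add_zero], rfl, rfl⟩
  | _ :: _, _, (_, _), (_, _), _, ⟨v, v', e, h, h'⟩ => by
    obtain ⟨u, u', rfl, k, k'⟩ := Bag.exists_of_add h
    obtain ⟨t, t', rfl, j, j'⟩ := exists_of_add h'
    exact ⟨u + t, u' + t', by rw [e, add_add_add_comm], ⟨_, _, rfl, k, j⟩, ⟨_, _, rfl, k', j'⟩⟩

theorem single : ∀ {Γ : List Ty} {R : ∀ {A : Ty}, Var Γ A → A.Ref → W → Prop} {A : Ty}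
    (x : Var Γ A) {a : A.Ref} {w : W}, R x a w → CtxBag Γ R (Ctx.single x a) w
  | _ :: _, _, _, .zero, _, _, h => ⟨_, 0, (add_zero _).symm, .single h, .zero⟩
  | _ :: _, _, _, .succ x, _, _, h => ⟨0, _, (zero_add _).symm, .zero, single x h⟩

theorem of_single : ∀ {Γ : List Ty} {R : ∀ {A : Ty}, Var Γ A → A.Ref → W → Prop} {A : Ty}
    (x : Var Γ A) {a : A.Ref} {w : W}, CtxBag Γ R (Ctx.single x a) w → R x a w
  | _ :: _, _, _, .zero, _, _, ⟨v, v', e, h, h'⟩ => by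
    rw [e, eq_zero h', add_zero]
    exact h.of_single
  | _ :: _, _, _, .succ x, _, _, ⟨v, v', e, h, h'⟩ => by
    rw [e, Bag.eq_zero h, zero_add]
    exact of_single x h'

end CtxBag

/-! ## Relational semantics of typing derivations -/

/-- The least fixed point of a relation between types of functions and weights. -/
inductive FixRel {α W : Type*} [AddCommMonoid W] (R : Multiset α × α → W → Prop) : α → W → Prop
  | unfold (b : α) (w : W) (l : List (α × W)) :
      R ((l.map Prod.fst : Multiset α), b) w → (∀ d ∈ l, FixRel R d.1 d.2) →
      FixRel R b (w + (l.map Prod.snd).sum)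

namespace FixRel

variable {α W : Type*} [AddCommMonoid W] {R : Multiset α × α → W → Prop}

theorem mk {m : Multiset α} {b : α} {w w' : W} (h : R (m, b) w) :
    Bag (FixRel R) m w' → FixRel R b (w + w') := by
  rintro ⟨l, rfl, rfl, hl⟩
  exact .unfold b w l h hl

/-- Repackages the nested induction over lists as an induction over bags: `X` only has to be closed
under one unfolding. -/
theorem induct {X : α → W → Prop}
    (hX : ∀ m b w w', R (m, b) w → Bag X m w' → X b (w + w')) {b : α} {w : W}
    (h : FixRel R b w) : X b w := by
  induction h with
  | unfold b w l h _ ih => exact hX _ b w _ h ⟨l, rfl, rfl, ih⟩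

end FixRel

/-- `D.sem a (γ, μ)`: there is a derivation of `γ ⊢ M : a` of weight `μ` that refines `D`. -/
def Typing.sem {n : ℕ} : {Γ : List Ty} → {M : Tm n} → {A : Ty} → Typing Γ M A →
    A.Ref → Ctx Γ × Mono n → Prop
  | _, _, _, .zeroN, k, w => k = (0 : ℕ) ∧ w = 0
  | _, _, _, .zeroB, c, w => c = (0 : Fin 2) ∧ w = 0
  | _, _, _, .oneB, c, w => c = (1 : Fin 2) ∧ w = 0
  | _, _, _, .cast D, k, w => ∃ c : Fin 2, k = (c : ℕ) ∧ D.sem c w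
  | _, _, _, .succ D, k, w => ∃ j : ℕ, k = (j + 1 : ℕ) ∧ D.sem j w
  | _, _, _, .pred D, k, w => ∃ j : ℕ, k = (j - 1 : ℕ) ∧ D.sem j w
  | _, _, _, .var v, a, w => w = (Ctx.single v a, 0)
  | _, _, _, .lam D, (m, b), (γ, μ) => D.sem b ((m, γ), μ)
  | _, _, _, .app D E, b, w => ∃ m v v', w = v + v' ∧ D.sem (m, b) v ∧ Bag E.sem m v'
  | _, _, _, .ite D E F, a, w => ∃ v v', w = v + v' ∧
      ((D.sem (0 : ℕ) v ∧ E.sem a v') ∨ ∃ k : ℕ, D.sem (k + 1 : ℕ) v ∧ F.sem a v')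
  | _, _, _, .choice k D E, a, w => ∃ v,
      (w = v + (0, Pi.single (k, false) 1) ∧ D.sem a v) ∨
      (w = v + (0, Pi.single (k, true) 1) ∧ E.sem a v)
  | _, _, _, .fix D, b, w => FixRel (α := Ty.Ref _) D.sem b w

/-! ### Derivations of `P` and `P_trop` compared with the relational semantics -/

section

variable {n : ℕ}

theorem Bag.of_args {Γ : List Ty} {A : Ty} {R : A.Ref → Ctx Γ × Mono n → Prop}
    (args : List (Ctx Γ × A.Ref × Mono n × ℕ))
    (h : ∀ d ∈ args, R d.2.1 (d.1, d.2.2.1)) :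
    Bag R (args.map (fun d => d.2.1) : Multiset A.Ref)
      ((args.map (fun d => d.1)).sum, (args.map (fun d => d.2.2.1)).sum) := by
  induction args with
  | nil => exact .zero
  | cons d l ih =>
    exact .cons (h d List.mem_cons_self) (ih fun d hd => h d (List.mem_cons_of_mem _ hd))

/-- The bag is finite, so the maximum of the thresholds of its elements works for all arguments at
once. Asking for all `p ≥ p₀` rather than a single `p` is what allows this combination. -/
theorem Bag.exists_args {Γ : List Ty} {A : Ty} {R : A.Ref → Ctx Γ × Mono n → Prop}
    {m : Multiset A.Ref} {w : Ctx Γ × Mono n} (h : Bag R m w) (Q : ℕ → Ctx Γ → A.Ref → Mono n →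
      ℕ → Prop) (hQ : ∀ a w, R a w → ∃ p₀ y, ∀ p, p₀ ≤ p → Q p w.1 a w.2 y) :
    ∃ args : List (Ctx Γ × A.Ref × Mono n × ℕ),
      m = (args.map (fun d => d.2.1) : Multiset A.Ref) ∧
      w = ((args.map (fun d => d.1)).sum, (args.map (fun d => d.2.2.1)).sum) ∧
      ∃ p₀, ∀ p, p₀ ≤ p → ∀ d ∈ args, Q p d.1 d.2.1 d.2.2.1 d.2.2.2 := by
  obtain ⟨l, rfl, rfl, hl⟩ := h
  induction l with
  | nil => exact ⟨[], rfl, rfl, 0, by simp⟩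
  | cons d l ih =>
    obtain ⟨args, hm, hw, p₀, hp₀⟩ := ih fun d hd => hl d (List.mem_cons_of_mem _ hd)
    obtain ⟨p₁, y, hp₁⟩ := hQ _ _ (hl d List.mem_cons_self)
    refine ⟨(d.2.1, d.1, d.2.2, y) :: args, ?_, ?_, max p₀ p₁, fun p hp e he => ?_⟩
    · exact congrArg (d.1 ::ₘ ·) hm
    · rw [List.map_cons, List.sum_cons, hw]
      rfl
    · rcases List.mem_cons.1 he with rfl | he
      · exact hp₁ p (le_trans (le_max_right _ _) hp)
      · exact hp₀ p (le_trans (le_max_left _ _) hp) e he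

theorem PDer.sem {p : ℕ} {Γ : List Ty} {M : Tm n} {A : Ty} {D : Typing Γ M A} {y : ℕ}
    {γ : Ctx Γ} {a : A.Ref} {μ : Mono n} (h : PDer p D y γ a μ) : D.sem a (γ, μ) := by
  induction h with
  | zeroN => exact ⟨rfl, rfl⟩
  | zeroB => exact ⟨rfl, rfl⟩
  | oneB => exact ⟨rfl, rfl⟩
  | cast _ ih => exact ⟨_, rfl, ih⟩
  | succ _ ih => exact ⟨_, rfl, ih⟩
  | pred _ ih => exact ⟨_, rfl, ih⟩
  | var v a _ => exact rfl
  | lam _ _ ih => exact ih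
  | app args _ _ _ ih ih' => exact ⟨_, _, _, rfl, ih, .of_args args ih'⟩
  | iteZero _ _ _ ih ih' => exact ⟨_, _, rfl, Or.inl ⟨ih, ih'⟩⟩
  | iteSucc _ _ _ ih ih' => exact ⟨_, _, rfl, Or.inr ⟨_, ih, ih'⟩⟩
  | left _ _ ih => exact ⟨_, Or.inl ⟨by rw [Prod.mk_add_mk, add_zero], ih⟩⟩
  | right _ _ ih => exact ⟨_, Or.inr ⟨by rw [Prod.mk_add_mk, add_zero], ih⟩⟩
  | fix args _ _ _ ih ih' => exact FixRel.mk ih (.of_args args ih')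

theorem exists_bound_of_forall_mem {α : Type*} (m : Multiset α) (P : ℕ → α → Prop)
    (h : ∀ a, ∃ p₀, ∀ p, p₀ ≤ p → P p a) : ∃ p₀, ∀ p, p₀ ≤ p → ∀ a ∈ m, P p a := by
  induction m using Multiset.induction_on with
  | empty => exact ⟨0, by simp⟩
  | cons a m ih =>
    obtain ⟨p₀, hp₀⟩ := ih
    obtain ⟨p₁, hp₁⟩ := h a
    refine ⟨max p₀ p₁, fun p hp b hb => ?_⟩
    rcases Multiset.mem_cons.1 hb with rfl | hb
    · exact hp₁ p (le_trans (le_max_right _ _) hp)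
    · exact hp₀ p (le_trans (le_max_left _ _) hp) b hb

theorem Ty.exists_atomsLe : ∀ (A : Ty) (a : A.Ref), ∃ p₀, ∀ p, p₀ ≤ p → A.AtomsLe p a
  | .bool, c => ⟨Fin.val (n := 2) c, fun _ h => h⟩
  | .nat, k => ⟨k, fun _ h => h⟩
  | .arr A B, (m, b) => by
    obtain ⟨p₀, h₀⟩ := exists_bound_of_forall_mem m (A.AtomsLe ·) (exists_atomsLe A)
    obtain ⟨p₁, h₁⟩ := exists_atomsLe B b
    exact ⟨max p₀ p₁, fun p hp =>
      ⟨h₀ p (le_trans (le_max_left _ _) hp), h₁ p (le_trans (le_max_right _ _) hp)⟩⟩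

theorem Ty.exists_bounded : ∀ (A : Ty) (a : A.Ref), ∃ p₀, ∀ p, p₀ ≤ p → A.Bounded p a
  | .bool, _ => ⟨0, fun _ _ => trivial⟩
  | .nat, _ => ⟨0, fun _ _ => trivial⟩
  | .arr A B, (m, b) => by
    obtain ⟨p₀, h₀⟩ := exists_bound_of_forall_mem m (fun p c => A.AtomsLe p c ∧ A.Bounded p c)
      fun c => by
        obtain ⟨p₀, h₀⟩ := A.exists_atomsLe c
        obtain ⟨p₁, h₁⟩ := exists_bounded A c
        exact ⟨max p₀ p₁, fun p hp =>
          ⟨h₀ p (le_trans (le_max_left _ _) hp), h₁ p (le_trans (le_max_right _ _) hp)⟩⟩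
    obtain ⟨p₁, h₁⟩ := exists_bounded B b
    refine ⟨max m.card (max p₀ p₁), fun p hp => ⟨le_trans (le_max_left _ _) hp, h₀ p ?_, h₁ p ?_⟩⟩
    · exact le_trans (le_trans (le_max_left _ _) (le_max_right _ _)) hp
    · exact le_trans (le_trans (le_max_right _ _) (le_max_right _ _)) hp

/-- A semantic typing has a finite witness, which involves finitely many types, and each of them is
bounded for large `p`. The number `y` of `Y`-rules is read off the witness and does not depend on
`p`. -/
theorem Typing.exists_pDer_of_sem {Γ : List Ty} {M : Tm n} {A : Ty} (D : Typing Γ M A) :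
    ∀ (a : A.Ref) (w : Ctx Γ × Mono n), D.sem a w →
      ∃ p₀ y, ∀ p, p₀ ≤ p → PDer p D y w.1 a w.2 := by
  induction D with
  | zeroN =>
    rintro _ _ ⟨rfl, rfl⟩
    exact ⟨0, 0, fun p _ => .zeroN⟩
  | zeroB =>
    rintro _ _ ⟨rfl, rfl⟩
    exact ⟨0, 0, fun p _ => .zeroB⟩
  | oneB =>
    rintro _ _ ⟨rfl, rfl⟩
    exact ⟨0, 0, fun p _ => .oneB⟩
  | cast D ih =>
    rintro _ w ⟨c, rfl, h⟩
    obtain ⟨p₀, y, hp⟩ := ih _ _ h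
    exact ⟨p₀, y, fun p h => .cast (hp p h)⟩
  | succ D ih =>
    rintro _ w ⟨c, rfl, h⟩
    obtain ⟨p₀, y, hp⟩ := ih _ _ h
    exact ⟨p₀, y, fun p h => .succ (hp p h)⟩
  | pred D ih =>
    rintro _ w ⟨c, rfl, h⟩
    obtain ⟨p₀, y, hp⟩ := ih _ _ h
    exact ⟨p₀, y, fun p h => .pred (hp p h)⟩
  | @var Γ A v =>
    rintro a _ rfl
    obtain ⟨p₀, hp⟩ := A.exists_bounded a
    exact ⟨p₀, 0, fun p h => .var v a (hp p h)⟩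
  | @lam Γ A B M D ih =>
    rintro ⟨m, b⟩ ⟨γ, μ⟩ h
    obtain ⟨p₀, y, hp⟩ := ih _ _ h
    obtain ⟨p₁, hp₁⟩ := (A.arr B).exists_bounded (m, b)
    exact ⟨max p₀ p₁, y, fun p h => .lam (hp₁ p (le_trans (le_max_right _ _) h))
      (hp p (le_trans (le_max_left _ _) h))⟩
  | @app Γ A B M N D E ih ih' =>
    rintro b _ ⟨m, v, v', rfl, h, h'⟩
    obtain ⟨p₀, y, hp⟩ := ih _ _ h
    obtain ⟨args, rfl, rfl, p₁, hp₁⟩ := h'.exists_args (fun p γ a μ y => PDer p E y γ a μ) ih'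
    obtain ⟨p₂, hp₂⟩ := B.exists_bounded b
    refine ⟨max p₀ (max p₁ p₂), _, fun p h => .app args (hp₂ p ?_) (hp p ?_) (hp₁ p ?_)⟩ <;>
      simp only [max_le_iff] at h <;> omega
  | @ite Γ A M N P D E F ih ih' ih'' =>
    obtain hb := A.exists_bounded
    rintro a _ ⟨v, v', rfl, ⟨h, h'⟩ | ⟨k, h, h'⟩⟩
    · obtain ⟨p₀, y, hp⟩ := ih _ _ h
      obtain ⟨p₁, z, hp₁⟩ := ih' _ _ h'
      obtain ⟨p₂, hp₂⟩ := hb a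
      refine ⟨max p₀ (max p₁ p₂), _, fun p h => .iteZero (hp₂ p ?_) (hp p ?_) (hp₁ p ?_)⟩ <;>
        simp only [max_le_iff] at h <;> omega
    · obtain ⟨p₀, y, hp⟩ := ih _ _ h
      obtain ⟨p₁, z, hp₁⟩ := ih'' _ _ h'
      obtain ⟨p₂, hp₂⟩ := hb a
      refine ⟨max p₀ (max p₁ p₂), _, fun p h => .iteSucc (hp₂ p ?_) (hp p ?_) (hp₁ p ?_)⟩ <;>
        simp only [max_le_iff] at h <;> omega
  | @choice Γ A M N k D E ih ih' =>
    rintro a _ ⟨v, ⟨rfl, h⟩ | ⟨rfl, h⟩⟩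
    · obtain ⟨p₀, y, hp⟩ := ih _ _ h
      obtain ⟨p₂, hp₂⟩ := A.exists_bounded a
      refine ⟨max p₀ p₂, y, fun p h => ?_⟩
      have := PDer.left (k := k) (E := E) (hp₂ p (le_trans (le_max_right _ _) h))
        (hp p (le_trans (le_max_left _ _) h))
      rwa [← add_zero v.1] at this
    · obtain ⟨p₀, y, hp⟩ := ih' _ _ h
      obtain ⟨p₂, hp₂⟩ := A.exists_bounded a
      refine ⟨max p₀ p₂, y, fun p h => ?_⟩
      have := PDer.right (k := k) (D := D) (hp₂ p (le_trans (le_max_right _ _) h))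
        (hp p (le_trans (le_max_left _ _) h))
      rwa [← add_zero v.1] at this
  | @fix Γ A M D ih =>
    intro b w h
    refine FixRel.induct (X := fun b w => ∃ p₀ y, ∀ p, p₀ ≤ p → PDer p (.fix D) y w.1 b w.2)
      (fun m b v v' h h' => ?_) h
    obtain ⟨p₀, y, hp⟩ := ih _ _ h
    obtain ⟨args, rfl, rfl, p₁, hp₁⟩ :=
      h'.exists_args (fun p γ a μ y => PDer p (.fix D) y γ a μ) fun _ _ h => h
    obtain ⟨p₂, hp₂⟩ := A.exists_bounded b
    refine ⟨max p₀ (max p₁ p₂), _, fun p h => .fix args (hp₂ p ?_) (hp p ?_) (hp₁ p ?_)⟩ <;>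
      simp only [max_le_iff] at h <;> omega

theorem Bag.of_mem_sum {Γ : List Ty} {A : Ty} {R : A.Ref → Ctx Γ × Mono n → Prop}
    {g : Ctx Γ → A.Ref → Set (Mono n)} (hg : ∀ γ a μ, μ ∈ g γ a → R a (γ, μ))
    (args : Multiset (Ctx Γ × A.Ref)) {μ : Mono n}
    (h : μ ∈ (args.map (fun d => g d.1 d.2)).sum) :
    Bag R (args.map Prod.snd) ((args.map Prod.fst).sum, μ) := by
  induction args using Multiset.induction_on generalizing μ with
  | empty =>
    rw [Multiset.map_zero, Multiset.sum_zero] at h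
    rw [show μ = 0 from h]
    exact .zero
  | cons d args ih =>
    rw [Multiset.map_cons, Multiset.sum_cons] at h
    obtain ⟨ν, hν, ξ, hξ, rfl⟩ := h
    rw [Multiset.map_cons, Multiset.map_cons, Multiset.sum_cons]
    exact .cons (hg _ _ _ hν) (ih hξ)

theorem exists_of_mem_applyRule {Γ : List Ty} {A B : Ty}
    {sel : Set (Ctx Γ × Multiset (Ctx Γ × A.Ref) × B.Ref)}
    {f : Ctx Γ → Multiset A.Ref × B.Ref → Set (Mono n)} {g : Ctx Γ → A.Ref → Set (Mono n)}
    {R : Multiset A.Ref × B.Ref → Ctx Γ × Mono n → Prop} {S : A.Ref → Ctx Γ × Mono n → Prop}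
    (hf : ∀ γ a μ, μ ∈ f γ a → R a (γ, μ)) (hg : ∀ γ a μ, μ ∈ g γ a → S a (γ, μ))
    {γ : Ctx Γ} {b : B.Ref} {μ : Mono n} (h : μ ∈ applyRule id sel f g γ b) :
    ∃ m v v', (γ, μ) = v + v' ∧ R (m, b) v ∧ Bag S m v' := by
  obtain ⟨γ₀, args, -, rfl, ν, hν, ξ, hξ, rfl⟩ := h
  exact ⟨_, _, _, rfl, hf _ _ _ hν, .of_mem_sum hg args hξ⟩

/-- Without minimization, every monomial in a parallel derivation comes from one choice of typings
in the premises. The selections `sel` only restrict which choices are available. -/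
theorem PTrop.sem_of_mem_judg {Γ : List Ty} {M : Tm n} {A : Ty} {D : Typing Γ M A}
    (π : PTrop D) : ∀ (γ : Ctx Γ) (a : A.Ref) (μ : Mono n), μ ∈ π.judg id γ a →
      D.sem a (γ, μ) := by
  induction π with
  | empty => exact fun _ _ _ h => h.elim
  | zeroN =>
    rintro _ _ _ ⟨rfl, rfl, rfl⟩
    exact ⟨rfl, rfl⟩
  | zeroB =>
    rintro _ _ _ ⟨rfl, rfl, rfl⟩
    exact ⟨rfl, rfl⟩
  | oneB =>
    rintro _ _ _ ⟨rfl, rfl, rfl⟩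
    exact ⟨rfl, rfl⟩
  | cast π ih =>
    rintro γ _ μ ⟨c, rfl, h⟩
    exact ⟨c, rfl, ih _ _ _ h⟩
  | succ π ih =>
    rintro γ _ μ ⟨c, rfl, h⟩
    exact ⟨c, rfl, ih _ _ _ h⟩
  | pred π ih =>
    rintro γ _ μ ⟨c, rfl, h⟩
    exact ⟨c, rfl, ih _ _ _ h⟩
  | var v I =>
    rintro _ a _ ⟨-, rfl, rfl⟩
    exact rfl
  | lam π ih =>
    rintro γ ⟨m, b⟩ μ h
    exact ih _ _ _ h
  | app sel π ρ ih ih' => exact fun γ b μ h => exists_of_mem_applyRule ih ih' h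
  | ite π ρ σ ih ih' ih'' =>
    rintro _ a μ ⟨γ, δ, rfl, ⟨ν, hν, ξ, hξ, rfl⟩ | ⟨k, ν, hν, ξ, hξ, rfl⟩⟩
    · exact ⟨_, _, rfl, Or.inl ⟨ih _ _ _ hν, ih' _ _ _ hξ⟩⟩
    · exact ⟨_, _, rfl, Or.inr ⟨k, ih _ _ _ hν, ih'' _ _ _ hξ⟩⟩
  | choice π ρ ih ih' =>
    rintro γ a μ (⟨ν, hν, ξ, rfl, rfl⟩ | ⟨ν, hν, ξ, rfl, rfl⟩)
    · exact ⟨(γ, ν), Or.inl ⟨by rw [Prod.mk_add_mk, add_zero], ih _ _ _ hν⟩⟩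
    · exact ⟨(γ, ν), Or.inr ⟨by rw [Prod.mk_add_mk, add_zero], ih' _ _ _ hν⟩⟩
  | fix sel π ρ ih ih' =>
    intro γ b μ h
    obtain ⟨m, v, v', e, hv, hv'⟩ := exists_of_mem_applyRule ih ih' h
    rw [e]
    exact FixRel.mk hv hv'

/-! ## Derivations collecting all bounded derivations -/

/-- All these multisets lie below `p` copies of `s`, and a multiset has finitely many submultisets.
-/
theorem Multiset.finite_card_le_of_forall_mem {α : Type*} {s : Set α} (hs : s.Finite) (p : ℕ) :
    {m : Multiset α | m.card ≤ p ∧ ∀ c ∈ m, c ∈ s}.Finite := by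
  classical
  refine (Set.finite_Iic (p • hs.toFinset.val)).subset fun m ⟨hm, hms⟩ => ?_
  refine Multiset.le_iff_count.2 fun a => ?_
  by_cases ha : a ∈ m
  · rw [Multiset.count_nsmul, Multiset.count_eq_one_of_mem hs.toFinset.nodup
      (hs.mem_toFinset.2 (hms a ha)), mul_one]
    exact (Multiset.count_le_card a m).trans hm
  · rw [Multiset.count_eq_zero_of_notMem ha]
    exact Nat.zero_le _

/-- Provides the finite index set of the identity axiom in `PTrop.collect`. The bound on atoms is
what makes the base type `nat` finite. -/
theorem Ty.finite_bounded (p : ℕ) : ∀ A : Ty, {a : A.Ref | A.AtomsLe p a ∧ A.Bounded p a}.Finite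
  | .bool => Set.toFinite (α := Fin 2) _
  | .nat => (Set.finite_Iic p).subset fun _ h => h.1
  | .arr A B => ((Multiset.finite_card_le_of_forall_mem (finite_bounded p A) p).prod
      (finite_bounded p B)).subset fun ⟨_, _⟩ h => ⟨⟨h.2.1, h.2.2.1⟩, h.1.2, h.2.2.2⟩

/-- All types in the context are bounded by `p`, as are their atoms. -/
def Ctx.Bounded (p : ℕ) : (Γ : List Ty) → Ctx Γ → Prop
  | [], _ => True
  | A :: Γ, (m, γ) => (∀ c ∈ m, A.AtomsLe p c ∧ A.Bounded p c) ∧ Ctx.Bounded p Γ γ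

namespace Ctx.Bounded

variable {p : ℕ}

theorem of_add : ∀ {Γ : List Ty} {γ δ : Ctx Γ}, Ctx.Bounded p Γ (γ + δ) →
    Ctx.Bounded p Γ γ ∧ Ctx.Bounded p Γ δ
  | [], _, _, _ => ⟨trivial, trivial⟩
  | _ :: _, (_, _), (_, _), ⟨h, h'⟩ =>
    ⟨⟨fun c hc => h c (Multiset.mem_add.2 (Or.inl hc)), (of_add h').1⟩,
      ⟨fun c hc => h c (Multiset.mem_add.2 (Or.inr hc)), (of_add h').2⟩⟩

theorem of_sum {Γ : List Ty} {l : List (Ctx Γ)} (h : Ctx.Bounded p Γ l.sum) :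
    ∀ γ ∈ l, Ctx.Bounded p Γ γ := by
  induction l with
  | nil => simp
  | cons δ l ih =>
    rw [List.sum_cons] at h
    rintro γ (_ | ⟨_, hγ⟩)
    exacts [h.of_add.1, ih h.of_add.2 γ hγ]

theorem of_single : ∀ {Γ : List Ty} {A : Ty} (v : Var Γ A) {a : A.Ref},
    Ctx.Bounded p Γ (Ctx.single v a) → A.AtomsLe p a ∧ A.Bounded p a
  | _ :: _, _, .zero, _, h => h.1 _ (Multiset.mem_singleton_self _)
  | _ :: _, _, .succ v, _, h => of_single v h.2

end Ctx.Bounded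

/-- A derivation that collects all derivations in `P` with at most `m` rules for `Y`, bounded
by `p`. -/
noncomputable def PTrop.collect (p : ℕ) : {Γ : List Ty} → {M : Tm n} → {A : Ty} →
    (D : Typing Γ M A) → ℕ → PTrop D
  | _, _, _, .zeroN, _ => .zeroN
  | _, _, _, .zeroB, _ => .zeroB
  | _, _, _, .oneB, _ => .oneB
  | _, _, _, .cast D, m => .cast (collect p D m)
  | _, _, _, .succ D, m => .succ (collect p D m)
  | _, _, _, .pred D, m => .pred (collect p D m)
  | _, _, _, .var (A := A) v, _ => .var v (A.finite_bounded p).toFinset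
  | _, _, _, .lam D, m => .lam (collect p D m)
  | _, _, _, .app D E, m => .app Set.univ (collect p D m) (collect p E m)
  | _, _, _, .ite D E F, m => .ite (collect p D m) (collect p E m) (collect p F m)
  | _, _, _, .choice _ D E, m => .choice (collect p D m) (collect p E m)
  -- The budget limits only the nesting of `Y` through argument premises: it drops by one there and
  -- is kept in the function premise. This is weaker than limiting the total count, hence enough to
  -- collect.
  | _, _, _, .fix D, m => Nat.rec (.empty _) (fun k π => .fix Set.univ (collect p D (k + 1)) π) m

theorem mem_applyRule_univ {Γ : List Ty} {A B : Ty}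
    {f : Ctx Γ → Multiset A.Ref × B.Ref → Set (Mono n)} {g : Ctx Γ → A.Ref → Set (Mono n)}
    (args : List (Ctx Γ × A.Ref × Mono n × ℕ)) {γ : Ctx Γ} {b : B.Ref} {μ : Mono n}
    (hf : μ ∈ f γ ((args.map (fun d => d.2.1) : Multiset A.Ref), b))
    (hg : ∀ d ∈ args, d.2.2.1 ∈ g d.1 d.2.1) :
    μ + (args.map (fun d => d.2.2.1)).sum ∈
      applyRule id Set.univ f g (γ + (args.map (fun d => d.1)).sum) b := by
  refine ⟨γ, (args.map fun d => (d.1, d.2.1) : List _), trivial, ?_, μ, ?_, _, ?_, rfl⟩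
  · rw [Multiset.map_coe, Multiset.sum_coe, List.map_map]
    rfl
  · rw [Multiset.map_coe, List.map_map]
    exact hf
  · rw [Multiset.map_coe, Multiset.sum_coe, List.map_map]
    clear hf
    induction args with
    | nil => exact rfl
    | cons d l ih =>
      exact Set.add_mem_add (hg d List.mem_cons_self)
        (ih fun d hd => hg d (List.mem_cons_of_mem _ hd))

/-- The identity axiom of `P` does not bound the atoms of a type at top level, while the index set
in `PTrop.collect` does. The missing bound is carried by the context: it enters at abstractions,
whose arrow types are bounded, and is passed down to the variables. -/
theorem PDer.mem_judg_collect {p : ℕ} {Γ : List Ty} {M : Tm n} {A : Ty} {D : Typing Γ M A} {y : ℕ}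
    {γ : Ctx Γ} {a : A.Ref} {μ : Mono n} (h : PDer p D y γ a μ) :
    ∀ m, y ≤ m → Ctx.Bounded p Γ γ → μ ∈ (PTrop.collect p D m).judg id γ a := by
  have hle : ∀ {Γ : List Ty} {A : Ty} (args : List (Ctx Γ × A.Ref × Mono n × ℕ)), ∀ d ∈ args,
      d.2.2.2 ≤ (args.map (fun d => d.2.2.2)).sum := fun args d hd =>
    List.single_le_sum (fun _ _ => Nat.zero_le _) _ (List.mem_map_of_mem hd)
  induction h with
  | zeroN => exact fun _ _ _ => ⟨rfl, rfl, rfl⟩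
  | zeroB => exact fun _ _ _ => ⟨rfl, rfl, rfl⟩
  | oneB => exact fun _ _ _ => ⟨rfl, rfl, rfl⟩
  | cast _ ih => exact fun m hm hγ => ⟨_, rfl, ih m hm hγ⟩
  | succ _ ih => exact fun m hm hγ => ⟨_, rfl, ih m hm hγ⟩
  | pred _ ih => exact fun m hm hγ => ⟨_, rfl, ih m hm hγ⟩
  | var v a _ =>
    exact fun m _ hγ => ⟨(Set.Finite.mem_toFinset _).2 (Ctx.Bounded.of_single v hγ), rfl, rfl⟩
  | lam ha _ ih => exact fun m hm hγ => ih m hm ⟨ha.2.1, hγ⟩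
  | app args _ _ _ ih ih' =>
    intro m hm hγ
    refine mem_applyRule_univ args (ih m (by omega) hγ.of_add.1) fun d hd => ?_
    exact ih' d hd m ((hle args d hd).trans (by omega))
      (hγ.of_add.2.of_sum _ (List.mem_map_of_mem hd))
  | iteZero _ _ _ ih ih' =>
    exact fun m hm hγ => ⟨_, _, rfl, Or.inl (Set.add_mem_add (ih m (by omega) hγ.of_add.1)
      (ih' m (by omega) hγ.of_add.2))⟩
  | iteSucc _ _ _ ih ih' =>
    exact fun m hm hγ => ⟨_, _, rfl, Or.inr ⟨_, Set.add_mem_add (ih m (by omega) hγ.of_add.1)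
      (ih' m (by omega) hγ.of_add.2)⟩⟩
  | left _ _ ih => exact fun m hm hγ => Or.inl (Set.add_mem_add (ih m hm hγ) rfl)
  | right _ _ ih => exact fun m hm hγ => Or.inr (Set.add_mem_add (ih m hm hγ) rfl)
  | fix args _ _ _ ih ih' =>
    rintro (_ | m) hm hγ
    -- A derivation that ends with the rule for `Y` uses it at least once, so budget `0` cannot
    -- occur.
    · omega
    refine mem_applyRule_univ args (ih (m + 1) (by omega) hγ.of_add.1) fun d hd => ?_
    exact ih' d hd m ((hle args d hd).trans (by omega))
      (hγ.of_add.2.of_sum _ (List.mem_map_of_mem hd))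

theorem PTrop.collects_collect {M : Tm n} (D : Typing [] M .bool) (i : Fin 2) (m p : ℕ) :
    (PTrop.collect p D m).Collects i m p := fun _ _ hy h => h.mem_judg_collect m hy trivial

/-! ## Substitution -/

namespace Tm

/-- Extension of a substitution by a term for the variable `0`. -/
def scons (N : Tm n) (σ : ℕ → Tm n) : ℕ → Tm n
  | 0 => N
  | k + 1 => σ k

theorem inst_eq (M N : Tm n) : M.inst N = M.subst (scons N var) := by
  unfold inst
  congr 1

theorem up_comp_upRen (σ : ℕ → Tm n) (f : ℕ → ℕ) : up σ ∘ upRen f = up (σ ∘ f) := by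
  funext k
  cases k <;> rfl

theorem subst_rename (M : Tm n) : ∀ (σ : ℕ → Tm n) (f : ℕ → ℕ),
    (M.rename f).subst σ = M.subst (σ ∘ f) := by
  induction M with
  | lam M ih =>
    intro σ f
    simp only [rename, subst, ih, up_comp_upRen]
  | _ => intro σ f; simp_all [rename, subst]

theorem up_var_comp (f : ℕ → ℕ) : up (n := n) (var ∘ f) = var ∘ upRen f := by
  funext k
  cases k <;> rfl

theorem rename_eq_subst (M : Tm n) : ∀ f : ℕ → ℕ, M.rename f = M.subst (var ∘ f) := by
  induction M with
  | lam M ih =>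
    intro f
    simp only [rename, subst, ih, up_var_comp]
  | _ => intro f; simp_all [rename, subst]

theorem rename_rename (M : Tm n) : ∀ f g : ℕ → ℕ, (M.rename f).rename g = M.rename (g ∘ f) := by
  intro f g
  rw [rename_eq_subst, subst_rename, rename_eq_subst M]
  rfl

theorem rename_up (σ : ℕ → Tm n) (f : ℕ → ℕ) :
    (fun k => (up σ k).rename (upRen f)) = up fun k => (σ k).rename f := by
  funext k
  cases k with
  | zero => rfl
  | succ k => simp only [up, rename_rename]; rfl

theorem rename_subst (M : Tm n) : ∀ (σ : ℕ → Tm n) (f : ℕ → ℕ),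
    (M.subst σ).rename f = M.subst fun k => (σ k).rename f := by
  induction M with
  | lam M ih =>
    intro σ f
    simp only [rename, subst, ih, rename_up]
  | _ => intro σ f; simp_all [rename, subst]

theorem subst_up (σ τ : ℕ → Tm n) :
    (fun k => (up σ k).subst (up τ)) = up fun k => (σ k).subst τ := by
  funext k
  cases k with
  | zero => rfl
  | succ k => simp only [up, subst_rename, rename_subst]; rfl

theorem subst_subst (M : Tm n) : ∀ σ τ : ℕ → Tm n,
    (M.subst σ).subst τ = M.subst fun k => (σ k).subst τ := by
  induction M with
  | lam M ih =>
    intro σ τ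
    simp only [subst, ih, subst_up]
  | _ => intro σ τ; simp_all [subst]

theorem subst_var (M : Tm n) : M.subst var = M := by
  have h : up (n := n) var = var := by
    funext k
    cases k <;> rfl
  induction M with
  | lam M ih => rw [subst, h, ih]
  | _ => simp_all [subst]

theorem inst_subst_up (M N : Tm n) (σ : ℕ → Tm n) :
    (M.subst (up σ)).inst N = M.subst (scons N σ) := by
  rw [inst_eq, subst_subst]
  congr 1
  funext k
  cases k with
  | zero => rfl
  | succ k =>
    show ((σ k).rename Nat.succ).subst _ = σ k
    rw [subst_rename]
    exact subst_var _

end Tm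

/-! ## Soundness: realizability -/

/-- `M` reduces to `N` by choosing letters with total weight `μ`. -/
def Reaches (M : Tm n) (μ : Mono n) (N : Tm n) : Prop :=
  ∃ l : List (Letter n), Red M l N ∧ μ = fun a => l.count a

theorem Red.append {M N P : Tm n} {l l' : List (Letter n)} (h : Red M l N) (h' : Red N l' P) :
    Red M (l ++ l') P := by
  induction h with
  | refl => exact h'
  | head s _ ih =>
    rw [List.append_assoc]
    exact .head s (ih h')

theorem Red.congr {f : Tm n → Tm n} (hf : ∀ {M N : Tm n} {l}, Step M l N → Step (f M) l (f N))
    {M N : Tm n} {l : List (Letter n)} (h : Red M l N) : Red (f M) l (f N) := by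
  induction h with
  | refl => exact .refl _
  | head s _ ih => exact .head (hf s) ih

namespace Reaches

theorem refl (M : Tm n) : Reaches M 0 M := ⟨[], .refl M, by simp; rfl⟩

theorem trans {M N P : Tm n} {μ ν : Mono n} : Reaches M μ N → Reaches N ν P →
    Reaches M (μ + ν) P := by
  rintro ⟨l, h, rfl⟩ ⟨l', h', rfl⟩
  exact ⟨_, h.append h', by funext a; simp⟩

theorem of_step {M N : Tm n} (h : Step M [] N) : Reaches M 0 N :=
  ⟨[] ++ [], .head h (.refl N), by simp; rfl⟩

theorem of_step_singleton {M N : Tm n} {a : Letter n} (h : Step M [a] N) :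
    Reaches M (Pi.single a 1) N :=
  ⟨[a] ++ [], .head h (.refl N), by
    funext b
    by_cases hb : b = a
    · subst hb; simp
    · simp [Ne.symm hb]⟩

theorem congr {f : Tm n → Tm n} (hf : ∀ {M N : Tm n} {l}, Step M l N → Step (f M) l (f N))
    {M N : Tm n} {μ : Mono n} : Reaches M μ N → Reaches (f M) μ (f N) := by
  rintro ⟨l, h, e⟩
  exact ⟨l, h.congr hf, e⟩

end Reaches

/-- `A.Realizes M a μ`: the term `M` behaves as prescribed by the type `a`, with weight `μ`. -/
def Ty.Realizes : (A : Ty) → Tm n → A.Ref → Mono n → Prop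
  | .bool, M, c, μ => Reaches M μ (.num (Fin.val (n := 2) c))
  | .nat, M, k, μ => Reaches M μ (.num k)
  | .arr A B, M, (m, b), μ => ∀ (N : Tm n) (ν : Mono n), Bag (A.Realizes N) m ν →
      B.Realizes (.app M N) b (μ + ν)

/-- Closure under expansion. At arrow types it holds because weak head reduction takes place in
function position. -/
theorem Ty.Realizes.of_reaches : ∀ {A : Ty} {M N : Tm n} {a : A.Ref} {μ ν : Mono n},
    Reaches M μ N → A.Realizes N a ν → A.Realizes M a (μ + ν)
  | .bool, _, _, _, _, _, h, h' => h.trans h'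
  | .nat, _, _, _, _, _, h, h' => h.trans h'
  | .arr _ _, _, _, (_, _), μ, ν, h, h' => fun N ξ hN => by
    rw [add_assoc]
    exact of_reaches (h.congr (f := fun M => .app M N) fun s => .appCongr N s) (h' N ξ hN)

theorem Ty.Realizes.of_step {A : Ty} {M N : Tm n} {a : A.Ref} {μ : Mono n}
    (h : Step M [] N) (h' : A.Realizes N a μ) : A.Realizes M a μ := by
  simpa using of_reaches (.of_step h) h'

/-- The substitution `σ` realizes a context. -/
def RealizesCtx {Γ : List Ty} (σ : ℕ → Tm n) (γ : Ctx Γ) (μ : Mono n) : Prop :=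
  CtxBag Γ (fun {A} x => A.Realizes (σ x.index)) γ μ

/-- Since contexts add up without contraction, the realizers of the summed context split into one
share per typing of `N`, and the weights split accordingly. -/
theorem Bag.realizes {Γ : List Ty} {A : Ty} {R : A.Ref → Ctx Γ × Mono n → Prop} {N : Tm n}
    {σ : ℕ → Tm n} (h : ∀ a γ μ ν, R a (γ, μ) → RealizesCtx σ γ ν → A.Realizes N a (μ + ν))
    {m : Multiset A.Ref} {γ : Ctx Γ} {μ ν : Mono n} (hm : Bag R m (γ, μ))
    (hγ : RealizesCtx σ γ ν) : Bag (A.Realizes N) m (μ + ν) := by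
  obtain ⟨l, rfl, e, hl⟩ := hm
  induction l generalizing γ μ ν with
  | nil =>
    obtain ⟨rfl, rfl⟩ := Prod.mk.inj e
    rw [show ν = 0 from CtxBag.eq_zero hγ]
    exact .zero
  | cons d l ih =>
    rw [List.map_cons, List.sum_cons] at e
    obtain ⟨rfl, rfl⟩ := Prod.mk.inj e
    obtain ⟨ξ, ξ', rfl, h₁, h₂⟩ := CtxBag.exists_of_add hγ
    rw [add_add_add_comm]
    exact .cons (h _ _ _ _ (hl d List.mem_cons_self) h₁)
      (ih h₂ rfl fun d hd => hl d (List.mem_cons_of_mem _ hd))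

/-- The fundamental lemma of realizability: the weight `μ` of the typing and the weight `ν` spent on
the substituted terms add up exactly, by non-idempotency. -/
theorem Typing.realizes_of_sem {Γ : List Ty} {M : Tm n} {A : Ty} (D : Typing Γ M A) :
    ∀ (a : A.Ref) (γ : Ctx Γ) (μ ν : Mono n) (σ : ℕ → Tm n), D.sem a (γ, μ) →
      RealizesCtx σ γ ν → A.Realizes (M.subst σ) a (μ + ν) := by
  induction D with
  | zeroN =>
    rintro a γ μ ν σ ⟨rfl, e⟩ hγ
    obtain ⟨rfl, rfl⟩ := Prod.mk.inj e
    rw [show ν = 0 from CtxBag.eq_zero hγ]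
    exact .refl _
  | zeroB =>
    rintro a γ μ ν σ ⟨rfl, e⟩ hγ
    obtain ⟨rfl, rfl⟩ := Prod.mk.inj e
    rw [show ν = 0 from CtxBag.eq_zero hγ]
    exact .refl _
  | oneB =>
    rintro a γ μ ν σ ⟨rfl, e⟩ hγ
    obtain ⟨rfl, rfl⟩ := Prod.mk.inj e
    rw [show ν = 0 from CtxBag.eq_zero hγ]
    exact .refl _
  | cast D ih =>
    rintro _ γ μ ν σ ⟨c, rfl, h⟩ hγ
    exact ih c γ μ ν σ h hγ
  | succ D ih =>
    rintro _ γ μ ν σ ⟨k, rfl, h⟩ hγ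
    exact Reaches.congr (f := .succ) (fun s => .succCongr s) (ih k γ μ ν σ h hγ)
  | pred D ih =>
    rintro _ γ μ ν σ ⟨k, rfl, h⟩ hγ
    have h' := Reaches.congr (f := .pred) (fun s => .predCongr s) (ih k γ μ ν σ h hγ)
    rw [← add_zero (μ + ν)]
    refine h'.trans ?_
    cases k with
    | zero => exact .of_step .predZero
    | succ k => exact .of_step (.predSucc _)
  | var v =>
    intro a γ μ ν σ h hγ
    obtain ⟨rfl, rfl⟩ := Prod.mk.inj h
    rw [zero_add]
    exact CtxBag.of_single v hγ
  | @lam Γ A B M D ih =>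
    rintro ⟨m, b⟩ γ μ ν σ h hγ N ξ hN
    refine .of_step (.beta _ _) ?_
    rw [Tm.inst_subst_up, add_assoc]
    -- The bag of realizers of the argument becomes the component of the extended substitution at
    -- the bound variable.
    exact ih b (m, γ) μ (ν + ξ) (Tm.scons N σ) h ⟨ξ, ν, add_comm _ _, hN, hγ⟩
  | app D E ih ih' =>
    rintro b γ μ ν σ ⟨m, v, v', e, h, h'⟩ hγ
    obtain ⟨rfl, rfl⟩ := Prod.mk.inj e
    obtain ⟨ξ, ξ', rfl, h₁, h₂⟩ := CtxBag.exists_of_add hγ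
    rw [add_add_add_comm]
    exact ih _ _ _ _ σ h h₁ _ _ (h'.realizes (fun a γ μ ν => ih' a γ μ ν σ) h₂)
  | ite D E F ih ih' ih'' =>
    rintro b γ μ ν σ ⟨v, v', e, h⟩ hγ
    obtain ⟨rfl, rfl⟩ := Prod.mk.inj e
    obtain ⟨ξ, ξ', rfl, h₁, h₂⟩ := CtxBag.exists_of_add hγ
    rw [add_add_add_comm]
    rcases h with ⟨h, h'⟩ | ⟨k, h, h'⟩
    · exact .of_reaches (Reaches.congr (f := fun M => .ite M _ _) (fun s => .iteCongr _ _ s)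
        (ih _ _ _ _ σ h h₁)) (.of_step (.iteZero _ _) (ih' _ _ _ _ σ h' h₂))
    · exact .of_reaches (Reaches.congr (f := fun M => .ite M _ _) (fun s => .iteCongr _ _ s)
        (ih _ _ _ _ σ h h₁)) (.of_step (.iteSucc k _ _) (ih'' _ _ _ _ σ h' h₂))
  | choice k D E ih ih' =>
    rintro b γ μ ν σ ⟨v, ⟨e, h⟩ | ⟨e, h⟩⟩ hγ <;>
    · obtain ⟨rfl, rfl⟩ := Prod.mk.inj e
      rw [add_zero] at hγ
      rw [add_right_comm, add_comm _ (Pi.single _ _)]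
      first
        | exact .of_reaches (.of_step_singleton (.left k _ _)) (ih _ _ _ _ σ h hγ)
        | exact .of_reaches (.of_step_singleton (.right k _ _)) (ih' _ _ _ _ σ h hγ)
  | @fix Γ A M D ih =>
    intro b γ μ ν σ h
    -- One unfolding step turns `Y M` into `M (Y M)`. The induction supplies the bag of realizers of
    -- the argument `Y M`.
    refine FixRel.induct (X := fun b w => ∀ ν, RealizesCtx σ w.1 ν →
      A.Realizes ((Tm.fix M).subst σ) b (w.2 + ν)) (fun m b v v' h h' ν hγ => ?_) h ν
    obtain ⟨ξ, ξ', rfl, h₁, h₂⟩ := CtxBag.exists_of_add hγ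
    rw [Prod.snd_add, add_add_add_comm]
    exact .of_step (.unfold _) (ih _ _ _ _ σ h h₁ _ _ (h'.realizes (fun a γ μ ν h => h ν) h₂))

theorem Typing.mem_trajectoryWeights_of_sem {M : Tm n} (D : Typing [] M .bool) {i : Fin 2}
    {μ : Mono n} (h : D.sem i (0, μ)) : μ ∈ trajectoryWeights M i := by
  have h' := D.realizes_of_sem i 0 μ 0 .var h rfl
  rw [Tm.subst_var, add_zero] at h'
  obtain ⟨l, hl, e⟩ := h'
  exact ⟨_, l, hl, rfl, e⟩

/-! ## Completeness: subject expansion -/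

/-- `w` is obtained from a typing related by `X` when each type in its context is replaced by a
typing related by `R`. -/
def Lift {Γ Δ : List Ty} (R : ∀ {A : Ty}, Var Γ A → A.Ref → Ctx Δ × Mono n → Prop) {α : Type}
    (X : α → Ctx Γ × Mono n → Prop) (a : α) (w : Ctx Δ × Mono n) : Prop :=
  ∃ γ μ w', w = w' + (0, μ) ∧ X a (γ, μ) ∧ CtxBag Γ R γ w'

namespace Lift

variable {Γ Δ : List Ty} {R : ∀ {A : Ty}, Var Γ A → A.Ref → Ctx Δ × Mono n → Prop} {α β γ : Type}
  {X : α → Ctx Γ × Mono n → Prop} {Y : β → Ctx Γ × Mono n → Prop}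
  {Z : γ → Ctx Γ × Mono n → Prop}

theorem map {a : α} {b : β} (h : ∀ w, X a w → Y b w) {w : Ctx Δ × Mono n} :
    Lift R X a w → Lift R Y b w := by
  rintro ⟨γ, μ, w', e, hX, hγ⟩
  exact ⟨γ, μ, w', e, h _ hX, hγ⟩

theorem add {a : α} {b : β} {c : γ} {v v' : Ctx Δ × Mono n}
    (h : ∀ w w', X a w → Y b w' → Z c (w + w')) :
    Lift R X a v → Lift R Y b v' → Lift R Z c (v + v') := by
  rintro ⟨γ, μ, w, rfl, hX, hγ⟩ ⟨γ', μ', w', rfl, hY, hγ'⟩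
  refine ⟨γ + γ', μ + μ', w + w', ?_, h _ _ hX hY, hγ.add hγ'⟩
  rw [add_add_add_comm, Prod.mk_add_mk (0 : Ctx Δ), add_zero]

theorem zero {a : α} (h : X a 0) : Lift R X a 0 :=
  ⟨0, 0, 0, (add_zero _).symm, h, .zero⟩

theorem bag {m : Multiset α} {w : Ctx Δ × Mono n} (h : Bag (Lift R X) m w) :
    Lift R (Bag X) m w := by
  induction m using Multiset.induction_on generalizing w with
  | empty =>
    rw [h.eq_zero]
    exact .zero .zero
  | cons a m ih =>
    obtain ⟨v, v', rfl, hv, hv'⟩ := h.exists_of_cons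
    exact .add (fun _ _ h h' => Bag.cons h h') hv (ih hv')

end Lift

/-- The relations for the variables under a binder. -/
def upRel {Γ Δ : List Ty} (C : Ty) (R : ∀ {A : Ty}, Var Γ A → A.Ref → Ctx Δ × Mono n → Prop) :
    ∀ {A : Ty}, Var (C :: Γ) A → A.Ref → Ctx (C :: Δ) × Mono n → Prop
  | _, .zero, a, w => w = (Ctx.single .zero a, 0)
  | _, .succ x, a, ((m, δ), μ) => m = 0 ∧ R x a (δ, μ)

theorem Ctx.of_mk_eq_add {Γ : List Ty} {A : Ty} {m m₁ m₂ : Multiset A.Ref} {γ γ₁ γ₂ : Ctx Γ}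
    {μ μ₁ μ₂ : Mono n} (h : (((m, γ) : Ctx (A :: Γ)), μ) =
      (((m₁, γ₁) : Ctx (A :: Γ)), μ₁) + (((m₂, γ₂) : Ctx (A :: Γ)), μ₂)) :
    m = m₁ + m₂ ∧ γ = γ₁ + γ₂ ∧ μ = μ₁ + μ₂ := by
  obtain ⟨e, e'⟩ := Prod.mk.inj h
  obtain ⟨e₁, e₂⟩ := Prod.mk.inj e
  exact ⟨e₁, e₂, e'⟩

/-- If no relation in the family uses the new variable, neither does any sum of typings it provides.
-/
theorem CtxBag.of_weak {Γ Δ : List Ty} {C : Ty}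
    {R : ∀ {A : Ty}, Var Γ A → A.Ref → Ctx Δ × Mono n → Prop}
    {R' : ∀ {A : Ty}, Var Γ A → A.Ref → Ctx (C :: Δ) × Mono n → Prop}
    (h : ∀ {A : Ty} (x : Var Γ A) (a : A.Ref) (m : Multiset C.Ref) (δ : Ctx Δ) (μ : Mono n),
      R' x a ((m, δ), μ) → m = 0 ∧ R x a (δ, μ)) {γ : Ctx Γ} {m : Multiset C.Ref} {δ : Ctx Δ}
    {μ : Mono n} (hγ : CtxBag Γ R' γ ((m, δ), μ)) : m = 0 ∧ CtxBag Γ R γ (δ, μ) := by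
  induction Γ generalizing m δ μ with
  | nil =>
    obtain ⟨e, rfl⟩ := Prod.mk.inj hγ
    obtain ⟨rfl, rfl⟩ := Prod.mk.inj e
    exact ⟨rfl, rfl⟩
  | cons A Γ ih =>
    obtain ⟨m₀, γ⟩ := γ
    obtain ⟨⟨⟨m₁, δ₁⟩, μ₁⟩, ⟨⟨m₂, δ₂⟩, μ₂⟩, e, hb, hc⟩ := hγ
    obtain ⟨rfl, rfl, rfl⟩ := Ctx.of_mk_eq_add e
    obtain ⟨rfl, hc'⟩ := ih (fun x => h (.succ x)) hc
    have key : ∀ (m₀ : Multiset A.Ref) {m₁ : Multiset C.Ref} {δ₁ : Ctx Δ} {μ₁ : Mono n},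
        Bag (R' .zero) m₀ (((m₁, δ₁) : Ctx (C :: Δ)), μ₁) →
          m₁ = 0 ∧ Bag (R .zero) m₀ (δ₁, μ₁) := by
      intro m₀
      induction m₀ using Multiset.induction_on with
      | empty =>
        intro m₁ δ₁ μ₁ hb
        obtain ⟨e, rfl⟩ := Prod.mk.inj hb.eq_zero
        obtain ⟨rfl, rfl⟩ := Prod.mk.inj e
        exact ⟨rfl, .zero⟩
      | cons a m₀ ih =>
        intro m₁ δ₁ μ₁ hb
        obtain ⟨⟨⟨m₁, δ₁⟩, μ₁⟩, ⟨⟨m₂, δ₂⟩, μ₂⟩, e, h₁, h₂⟩ := hb.exists_of_cons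
        obtain ⟨rfl, rfl, rfl⟩ := Ctx.of_mk_eq_add e
        obtain ⟨rfl, h₁'⟩ := h _ _ _ _ _ h₁
        obtain ⟨rfl, h₂'⟩ := ih h₂
        exact ⟨rfl, .cons h₁' h₂'⟩
    obtain ⟨rfl, hb'⟩ := key m₀ hb
    exact ⟨rfl, _, _, rfl, hb', hc'⟩

theorem Bag.eq_of_single_zero {Δ : List Ty} {C : Ty} {m : Multiset C.Ref}
    {w : Ctx (C :: Δ) × Mono n} (h : Bag (fun a w => w = (Ctx.single .zero a, 0)) m w) :
    w = (((m, (0 : Ctx Δ)) : Ctx (C :: Δ)), 0) := by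
  induction m using Multiset.induction_on generalizing w with
  | empty => exact h.eq_zero
  | cons a m ih =>
    obtain ⟨v, v', rfl, rfl, h'⟩ := h.exists_of_cons
    rw [ih h']
    refine Prod.ext (Prod.ext rfl (add_zero _)) (add_zero _)

/-- Under a binder the bound variable is replaced by itself, so its types pass through unchanged,
and the typings of the other terms do not mention it. -/
theorem CtxBag.of_up {Γ Δ : List Ty} {C : Ty}
    {R : ∀ {A : Ty}, Var Γ A → A.Ref → Ctx Δ × Mono n → Prop}
    {R' : ∀ {A : Ty}, Var (C :: Γ) A → A.Ref → Ctx (C :: Δ) × Mono n → Prop}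
    (h₀ : ∀ a w, R' .zero a w → w = (Ctx.single .zero a, 0))
    (h₁ : ∀ {A : Ty} (x : Var Γ A) (a : A.Ref) (m : Multiset C.Ref) (δ : Ctx Δ) (μ : Mono n),
      R' (.succ x) a ((m, δ), μ) → m = 0 ∧ R x a (δ, μ)) {γ : Ctx Γ}
    {m m' : Multiset C.Ref} {δ : Ctx Δ} {μ : Mono n}
    (h : CtxBag (C :: Γ) R' (m, γ) ((m', δ), μ)) : m' = m ∧ CtxBag Γ R γ (δ, μ) := by
  obtain ⟨v, ⟨⟨m₂, δ₂⟩, μ₂⟩, e, hb, hc⟩ := h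
  obtain rfl := Bag.eq_of_single_zero (hb.mono h₀)
  obtain ⟨rfl, hc'⟩ := CtxBag.of_weak (R := R) h₁ hc
  obtain ⟨rfl, rfl, rfl⟩ := Ctx.of_mk_eq_add e
  refine ⟨add_zero _, ?_⟩
  rwa [zero_add, zero_add]

theorem Ctx.of_mk_eq_single_succ {Γ : List Ty} {A C : Ty} (x : Var Γ A) (a : A.Ref)
    (m : Multiset C.Ref) (δ : Ctx Γ) (μ : Mono n)
    (h : (((m, δ) : Ctx (C :: Γ)), μ) = (Ctx.single (.succ x) a, 0)) :
    m = 0 ∧ (δ, μ) = (Ctx.single x a, 0) := by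
  obtain ⟨e, rfl⟩ := Prod.mk.inj h
  obtain ⟨rfl, rfl⟩ := Prod.mk.inj e
  exact ⟨rfl, rfl⟩

theorem CtxBag.eq_of_single {Γ : List Ty} {γ γ' : Ctx Γ} {μ : Mono n}
    (h : CtxBag Γ (fun x a w => w = (Ctx.single x a, 0)) γ (γ', μ)) : γ' = γ ∧ μ = 0 := by
  induction Γ generalizing μ with
  | nil => exact ⟨rfl, (Prod.mk.inj h).2⟩
  | cons B Γ ih =>
    obtain ⟨m, γ⟩ := γ
    obtain ⟨m', γ'⟩ := γ'
    obtain ⟨rfl, h'⟩ := CtxBag.of_up (R := fun x a w => w = (Ctx.single x a, 0))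
      (fun _ _ h => h) Ctx.of_mk_eq_single_succ h
    obtain ⟨rfl, rfl⟩ := ih h'
    exact ⟨rfl, rfl⟩

/-- A class of substitutions, whose values are typed as prescribed by a family of relations, that
is closed under passing below a binder. -/
structure SubstClass (n : ℕ) where
  mem : ∀ {Γ Δ : List Ty}, (ℕ → Tm n) →
    (∀ {A : Ty}, Var Γ A → A.Ref → Ctx Δ × Mono n → Prop) → Prop
  exists_typing : ∀ {Γ Δ : List Ty} {σ : ℕ → Tm n}
    {R : ∀ {A : Ty}, Var Γ A → A.Ref → Ctx Δ × Mono n → Prop}, mem σ R →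
    ∀ {A : Ty} (x : Var Γ A), ∃ S : Typing Δ (σ x.index) A, ∀ a w, S.sem a w → R x a w
  up : ∀ {Γ Δ : List Ty} {σ : ℕ → Tm n}
    {R : ∀ {A : Ty}, Var Γ A → A.Ref → Ctx Δ × Mono n → Prop} (C : Ty), mem σ R →
    mem (Tm.up σ) (upRel C R)

/-- Anti-substitution: a typing of `M[σ]` splits into a typing of `M` and typings of the copies of
the substituted terms. Abstracting over a class `K` allows one induction to serve for renamings
first, and then for typed substitutions, whose passage under binders needs renamings. -/
theorem SubstClass.exists_subst (K : SubstClass n) {Γ : List Ty} {M : Tm n} {A : Ty}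
    (D : Typing Γ M A) : ∀ {Δ : List Ty} {σ : ℕ → Tm n}
    {R : ∀ {A : Ty}, Var Γ A → A.Ref → Ctx Δ × Mono n → Prop}, K.mem σ R →
    ∃ D' : Typing Δ (M.subst σ) A, ∀ a w, D'.sem a w → Lift R D.sem a w := by
  induction D with
  | zeroN =>
    intro Δ σ R _
    refine ⟨.zeroN, ?_⟩
    rintro _ _ ⟨rfl, rfl⟩
    exact .zero ⟨rfl, rfl⟩
  | zeroB =>
    intro Δ σ R _
    refine ⟨.zeroB, ?_⟩
    rintro _ _ ⟨rfl, rfl⟩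
    exact .zero ⟨rfl, rfl⟩
  | oneB =>
    intro Δ σ R _
    refine ⟨.oneB, ?_⟩
    rintro _ _ ⟨rfl, rfl⟩
    exact .zero ⟨rfl, rfl⟩
  | cast D ih =>
    intro Δ σ R hσ
    obtain ⟨D', h⟩ := ih hσ
    refine ⟨.cast D', ?_⟩
    rintro _ w ⟨c, rfl, hc⟩
    exact (h c w hc).map fun w hw => ⟨c, rfl, hw⟩
  | succ D ih =>
    intro Δ σ R hσ
    obtain ⟨D', h⟩ := ih hσ
    refine ⟨.succ D', ?_⟩
    rintro _ w ⟨c, rfl, hc⟩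
    exact (h c w hc).map fun w hw => ⟨c, rfl, hw⟩
  | pred D ih =>
    intro Δ σ R hσ
    obtain ⟨D', h⟩ := ih hσ
    refine ⟨.pred D', ?_⟩
    rintro _ w ⟨c, rfl, hc⟩
    exact (h c w hc).map fun w hw => ⟨c, rfl, hw⟩
  | var v =>
    intro Δ σ R hσ
    obtain ⟨S, h⟩ := K.exists_typing hσ v
    exact ⟨S, fun a w hw => ⟨_, 0, w, (add_zero _).symm, rfl, .single v (h a w hw)⟩⟩
  | @lam Γ A B M D ih =>
    intro Δ σ R hσ
    obtain ⟨D', h⟩ := ih (K.up A hσ)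
    refine ⟨.lam D', ?_⟩
    rintro ⟨m, b⟩ ⟨δ, μ⟩ hw
    obtain ⟨⟨m', γ⟩, ν, ⟨⟨m'', δ'⟩, μ'⟩, e, hD, hγ⟩ := h _ _ hw
    -- The zero context in `Lift` has to be read as a pair of zeros, which the named arguments
    -- supply.
    obtain ⟨rfl, rfl, rfl⟩ := Ctx.of_mk_eq_add (m₂ := 0) (γ₂ := 0) e
    obtain ⟨rfl, hγ'⟩ := CtxBag.of_up (R := R) (fun _ _ h => h) (fun _ _ _ _ _ h => h) hγ
    refine ⟨γ, ν, (δ', μ'), rfl, ?_, hγ'⟩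
    show D.sem b ((m'' + 0, γ), ν)
    rw [show m'' + 0 = m'' from add_zero m'']
    exact hD
  | app D E ih ih' =>
    intro Δ σ R hσ
    obtain ⟨D', h⟩ := ih hσ
    obtain ⟨E', h'⟩ := ih' hσ
    refine ⟨.app D' E', ?_⟩
    rintro b _ ⟨m, v, v', rfl, hv, hv'⟩
    exact .add (fun w w' hw hw' => ⟨m, w, w', rfl, hw, hw'⟩) (h _ _ hv) (Lift.bag (hv'.mono h'))
  | ite D E F ih ih' ih'' =>
    intro Δ σ R hσ
    obtain ⟨D', h⟩ := ih hσ
    obtain ⟨E', h'⟩ := ih' hσ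
    obtain ⟨F', h''⟩ := ih'' hσ
    refine ⟨.ite D' E' F', ?_⟩
    rintro b _ ⟨v, v', rfl, ⟨hv, hv'⟩ | ⟨k, hv, hv'⟩⟩
    · exact .add (fun w w' hw hw' => ⟨w, w', rfl, Or.inl ⟨hw, hw'⟩⟩) (h _ _ hv) (h' _ _ hv')
    · exact .add (fun w w' hw hw' => ⟨w, w', rfl, Or.inr ⟨k, hw, hw'⟩⟩) (h _ _ hv) (h'' _ _ hv')
  | choice k D E ih ih' =>
    intro Δ σ R hσ
    obtain ⟨D', h⟩ := ih hσ
    obtain ⟨E', h'⟩ := ih' hσ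
    refine ⟨.choice k D' E', ?_⟩
    rintro b _ ⟨v, ⟨rfl, hv⟩ | ⟨rfl, hv⟩⟩
    · obtain ⟨γ, μ, w, rfl, hD, hγ⟩ := h _ _ hv
      refine ⟨γ, μ + Pi.single (k, false) 1, w, ?_, ⟨_, Or.inl ⟨?_, hD⟩⟩, hγ⟩
      · rw [add_assoc, Prod.mk_add_mk (0 : Ctx Δ), add_zero]
      · rw [Prod.mk_add_mk, add_zero]
    · obtain ⟨γ, μ, w, rfl, hD, hγ⟩ := h' _ _ hv
      refine ⟨γ, μ + Pi.single (k, true) 1, w, ?_, ⟨_, Or.inr ⟨?_, hD⟩⟩, hγ⟩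
      · rw [add_assoc, Prod.mk_add_mk (0 : Ctx Δ), add_zero]
      · rw [Prod.mk_add_mk, add_zero]
  | fix D ih =>
    intro Δ σ R hσ
    obtain ⟨D', h⟩ := ih hσ
    refine ⟨.fix D', fun b w hw => ?_⟩
    exact FixRel.induct (X := Lift R (FixRel D.sem)) (fun m b v v' hv hv' =>
      .add (fun _ _ hw hw' => FixRel.mk hw hw') (h _ _ hv) (Lift.bag hv')) hw

/-- Renamings. -/
def renamingClass (n : ℕ) : SubstClass n where
  mem {Γ Δ} σ R := ∃ f : ℕ → ℕ, σ = Tm.var ∘ f ∧ ∀ {A : Ty} (x : Var Γ A),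
    ∃ y : Var Δ A, y.index = f x.index ∧ ∀ a, R x a (Ctx.single y a, 0)
  exists_typing := by
    rintro Γ Δ _ R ⟨f, rfl, hf⟩ A x
    obtain ⟨y, hy, hR⟩ := hf x
    rw [Function.comp_apply, ← hy]
    refine ⟨.var y, ?_⟩
    rintro a _ rfl
    exact hR a
  up := by
    rintro Γ Δ _ R C ⟨f, rfl, hf⟩
    refine ⟨Tm.upRen f, Tm.up_var_comp f, ?_⟩
    rintro A (_ | x)
    · exact ⟨.zero, rfl, fun a => rfl⟩
    · obtain ⟨y, hy, hR⟩ := hf x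
      exact ⟨.succ y, congrArg (· + 1) hy, fun a => ⟨rfl, hR a⟩⟩

theorem Typing.exists_weaken {Γ : List Ty} {M : Tm n} {A : Ty} (D : Typing Γ M A) (C : Ty) :
    ∃ D' : Typing (C :: Γ) (M.rename Nat.succ) A, ∀ a m γ μ, D'.sem a ((m, γ), μ) →
      m = 0 ∧ D.sem a (γ, μ) := by
  rw [Tm.rename_eq_subst]
  obtain ⟨D', h⟩ := (renamingClass n).exists_subst D (Δ := C :: Γ) (σ := Tm.var ∘ Nat.succ)
    (R := fun x a w => w = (Ctx.single (.succ x) a, 0))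
    ⟨Nat.succ, rfl, fun x => ⟨.succ x, rfl, fun a => rfl⟩⟩
  refine ⟨D', fun a m γ μ hw => ?_⟩
  obtain ⟨γ', ν, ⟨⟨m', γ''⟩, μ'⟩, e, hD, hγ⟩ := h _ _ hw
  obtain ⟨rfl, rfl, rfl⟩ := Ctx.of_mk_eq_add (m₂ := 0) (γ₂ := 0) e
  obtain ⟨rfl, hγ'⟩ := CtxBag.of_weak (R := fun x a w => w = (Ctx.single x a, 0)) 
    Ctx.of_mk_eq_single_succ hγ
  obtain ⟨rfl, rfl⟩ := hγ'.eq_of_single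
  refine ⟨add_zero _, ?_⟩
  rw [add_zero, zero_add]
  exact hD

/-- Substitutions of typed terms. -/
def typedClass (n : ℕ) : SubstClass n where
  mem {Γ Δ} σ R := ∀ {A : Ty} (x : Var Γ A),
    ∃ S : Typing Δ (σ x.index) A, ∀ a w, S.sem a w → R x a w
  exists_typing h := h
  up := by
    rintro Γ Δ σ R C h A (_ | x)
    · exact ⟨.var .zero, fun a w hw => hw⟩
    · obtain ⟨S, hS⟩ := h x
      obtain ⟨S', hS'⟩ := S.exists_weaken C
      refine ⟨S', ?_⟩
      rintro a ⟨⟨m, δ⟩, μ⟩ hw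
      obtain ⟨hm, hw⟩ := hS' _ _ _ _ hw
      exact ⟨hm, hS _ _ hw⟩

/-- With variable `0` related to `E.sem` and the others to identity axioms, the bag found at
variable `0` is precisely the family of argument typings required by an application. -/
theorem Typing.exists_inst {Γ : List Ty} {M N : Tm n} {A B : Ty} (D : Typing (A :: Γ) M B)
    (E : Typing Γ N A) : ∃ D' : Typing Γ (M.inst N) B,
      ∀ b w, D'.sem b w → (Typing.app (.lam D) E).sem b w := by
  rw [Tm.inst_eq]
  obtain ⟨D', h⟩ := (typedClass n).exists_subst D (σ := Tm.scons N Tm.var)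
    (R := fun {C} (x : Var (A :: Γ) C) => match C, x with
      | _, .zero => E.sem
      | _, .succ x => fun a w => w = (Ctx.single x a, 0)) (by
    rintro C (_ | x)
    · exact ⟨E, fun _ _ h => h⟩
    · exact ⟨.var x, fun _ _ h => h⟩)
  refine ⟨D', fun b w hw => ?_⟩
  obtain ⟨⟨m, γ⟩, μ, _, rfl, hD, ⟨δ, μ'⟩, ⟨γ', ν⟩, rfl, hE, hγ⟩ := h b w hw
  obtain ⟨rfl, rfl⟩ := CtxBag.eq_of_single hγ
  refine ⟨m, (γ', μ), (δ, μ'), ?_, hD, hE⟩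
  simp only [Prod.mk_add_mk, add_zero]
  rw [add_comm γ', add_comm μ]

/-- Simple typings of numerals are not unique, since small ones may also come from Booleans by
`cast`; the value is the same for each of them. -/
theorem Typing.sem_num {Γ : List Ty} {k : ℕ} (D : Typing (n := n) Γ (.num k) .nat) :
    D.sem (k : ℕ) 0 := by
  induction k with
  | zero =>
    cases D with
    | zeroN => exact ⟨rfl, rfl⟩
    | cast D =>
      cases D
      exact ⟨0, rfl, rfl, rfl⟩
  | succ k ih =>
    cases k with
    | zero =>
      cases D with
      | succ D => exact ⟨0, rfl, ih D⟩
      | cast D =>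
        cases D
        exact ⟨1, rfl, rfl, rfl⟩
    | succ k =>
      cases D with
      | succ D => exact ⟨k + 1, rfl, ih D⟩
      | cast D => cases D

/-- Subject expansion. The simple typing of the reduct is constructed from `D`, and only the
backward transfer of semantic typings is needed. The letter chosen by the step is added to the
weight. -/
theorem Step.exists_typing {Γ : List Ty} {M : Tm n} {A : Ty} (D : Typing Γ M A) :
    ∀ {M' : Tm n} {l : List (Letter n)}, Step M l M' →
      ∃ D' : Typing Γ M' A, ∀ a w, D'.sem a w → D.sem a (w + (0, fun b => l.count b)) := by
  have hnil : ∀ {Γ : List Ty} (w : Ctx Γ × Mono n),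
      w + (0, fun b => ([] : List (Letter n)).count b) = w := fun w => by
    simp only [List.count_nil]
    exact add_zero w
  have hone : ∀ b : Letter n, (fun c => [b].count c : Mono n) = Pi.single b 1 := fun b => by
    funext c
    by_cases hc : c = b
    · subst hc; simp
    · simp [hc, Ne.symm hc]
  induction D with
  | zeroN => rintro _ _ ⟨⟩
  | zeroB => rintro _ _ ⟨⟩
  | oneB =>
    rintro _ _ (_ | _ | _ | _ | _ | _ | _ | _ | _ | _ | _ | h)
    cases h
  | var v => rintro _ _ ⟨⟩
  | lam D _ => rintro _ _ ⟨⟩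
  | cast D ih =>
    intro M' l h
    obtain ⟨D', hD⟩ := ih h
    exact ⟨.cast D', by rintro _ w ⟨c, rfl, hw⟩; exact ⟨c, rfl, hD _ _ hw⟩⟩
  | succ D ih =>
    intro M' l h
    cases h with
    | succCongr h =>
      obtain ⟨D', hD⟩ := ih h
      exact ⟨.succ D', by rintro _ w ⟨c, rfl, hw⟩; exact ⟨c, rfl, hD _ _ hw⟩⟩
  | pred D ih =>
    intro M' l h
    cases h with
    | predCongr h =>
      obtain ⟨D', hD⟩ := ih h
      exact ⟨.pred D', by rintro _ w ⟨c, rfl, hw⟩; exact ⟨c, rfl, hD _ _ hw⟩⟩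
    | predZero =>
      refine ⟨.zeroN, ?_⟩
      rintro _ _ ⟨rfl, rfl⟩
      rw [hnil]
      exact ⟨0, rfl, D.sem_num (k := 0)⟩
    | predSucc M =>
      cases D with
      | succ D =>
        refine ⟨D, fun k w hw => ?_⟩
        rw [hnil]
        exact ⟨Nat.succ k, rfl, k, rfl, hw⟩
      -- Here the argument of `pred` is the Boolean `1`, so the reduct is `0`.
      | cast D =>
        cases D
        refine ⟨.zeroN, ?_⟩
        rintro _ _ ⟨rfl, rfl⟩
        rw [hnil]
        exact ⟨1, rfl, 1, rfl, rfl, rfl⟩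
  | app D E ih ih' =>
    intro M' l h
    cases h with
    | appCongr _ h =>
      obtain ⟨D', hD⟩ := ih h
      refine ⟨.app D' E, ?_⟩
      rintro b _ ⟨m, v, v', rfl, hv, hv'⟩
      exact ⟨m, _, v', add_right_comm _ _ _, hD _ _ hv, hv'⟩
    | beta M N =>
      cases D with
      | lam D =>
        obtain ⟨D', h⟩ := D.exists_inst E
        exact ⟨D', fun b w hw => by rw [hnil]; exact h b w hw⟩
  | ite D E F ih ih' ih'' =>
    intro M' l h
    cases h with
    | iteCongr _ _ h =>
      obtain ⟨D', hD⟩ := ih h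
      refine ⟨.ite D' E F, ?_⟩
      rintro b _ ⟨v, v', rfl, ⟨hv, hv'⟩ | ⟨k, hv, hv'⟩⟩
      · exact ⟨_, v', add_right_comm _ _ _, Or.inl ⟨hD _ _ hv, hv'⟩⟩
      · exact ⟨_, v', add_right_comm _ _ _, Or.inr ⟨k, hD _ _ hv, hv'⟩⟩
    | iteZero =>
      refine ⟨E, fun a w hw => ?_⟩
      rw [hnil]
      exact ⟨0, w, (zero_add w).symm, Or.inl ⟨D.sem_num (k := 0), hw⟩⟩
    | iteSucc k =>
      refine ⟨F, fun a w hw => ?_⟩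
      rw [hnil]
      exact ⟨0, w, (zero_add w).symm, Or.inr ⟨k, D.sem_num (k := k + 1), hw⟩⟩
  | choice k D E ih ih' =>
    intro M' l h
    cases h with
    | left => exact ⟨D, fun a w hw => ⟨w, Or.inl ⟨by rw [hone], hw⟩⟩⟩
    | right => exact ⟨E, fun a w hw => ⟨w, Or.inr ⟨by rw [hone], hw⟩⟩⟩
  | fix D ih =>
    intro M' l h
    cases h
    refine ⟨.app D (.fix D), ?_⟩
    rintro b _ ⟨m, v, v', rfl, hv, hv'⟩
    rw [hnil]
    exact FixRel.mk hv hv'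

/-- Expansion is iterated from the numeral backwards; a Boolean numeral is typed only by its axiom,
with weight `0`. -/
theorem Red.sem_of_num {M N : Tm n} {l : List (Letter n)} (h : Red M l N) {i : Fin 2}
    (hN : N = .num i) (D : Typing [] M .bool) : D.sem i (0, fun b => l.count b) := by
  induction h with
  | refl =>
    subst hN
    have e : ((0 : Ctx []), (fun b => ([] : List (Letter n)).count b : Mono n)) = 0 := by
      simp only [List.count_nil]
      rfl
    rw [e]
    fin_cases i
    · cases D
      exact ⟨rfl, rfl⟩
    · cases D
      exact ⟨rfl, rfl⟩
  | head s _ ih =>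
    obtain ⟨D', h⟩ := s.exists_typing D
    have h' := h _ _ (ih hN D')
    rw [Prod.mk_add_mk, add_zero] at h'
    convert h' using 2
    funext b
    simp [add_comm]

/-! ### Explored trajectories against all trajectories -/

theorem exists_pDer_of_mem_trajectoryWeights {M : Tm n} (D : Typing [] M .bool) {i : Fin 2}
    {μ : Mono n} (h : μ ∈ trajectoryWeights M i) :
    ∃ p₀ y, ∀ p, p₀ ≤ p → PDer p D y 0 i μ := by
  obtain ⟨_, l, hl, -, rfl⟩ := h
  exact D.exists_pDer_of_sem _ _ (hl.sem_of_num rfl D)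

theorem PTrop.traj_subset {M : Tm n} {D : Typing [] M .bool} (π : PTrop D) (i : Fin 2) :
    π.traj i ⊆ trajectoryWeights M i := fun _ h =>
  D.mem_trajectoryWeights_of_sem (π.sem_of_mem_judg _ _ _ h)

theorem PTrop.dominates_traj {M : Tm n} {D : Typing [] M .bool} (π : PTrop D) (i : Fin 2) :
    Dominates (π.poly i) (π.traj i) := π.dominates_judg 0 i

/-- Any given trajectory is explored after enlarging both bounds, and the polynomial found there
dominates its weight. By stability this is the polynomial already at hand, although the bounds
needed depend on the trajectory. -/
theorem StableAt.dominates {M : Tm n} {D : Typing [] M .bool} {π : ℕ → ℕ → PTrop D} {i : Fin 2}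
    (hπ : ∀ m p, (π m p).Collects i m p) {m p : ℕ} (h : StableAt π i m p) :
    Dominates ((π m p).poly i) (trajectoryWeights M i) := by
  refine ⟨((π m p).dominates_traj i).subset.trans ((π m p).traj_subset i), fun x ν hν => ?_⟩
  obtain ⟨p₀, y, hp⟩ := exists_pDer_of_mem_trajectoryWeights D hν
  have hmem := hπ (max m y) (max p p₀) y ν (le_max_right _ _) (hp _ (le_max_right _ _))
  rw [← h (max m y) (max p p₀) (le_max_left _ _) (le_max_left _ _)]
  exact ((π (max m y) (max p p₀)).dominates_traj i).exists_le x ν hmem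

end

theorem mainTheorem11 {n : ℕ} {M : Tm n} (D : Typing [] M .bool) (i : Fin 2) :
    -- the derivations collecting all `P`-derivations within given bounds exist
    (∀ m p : ℕ, ∃ π : PTrop D, π.Collects i m p) ∧
    -- any derivation, relatively to the trajectories it explores
    (∀ π : PTrop D,
      π.traj i ⊆ trajectoryWeights M i ∧
      (∃ w, IsTraceback M i (π.poly i) w) ∧
      ∀ w, IsTraceback M i (π.poly i) w →
        IdentifiesMostLikely M i (selectedTrajs (π.poly i) w) (π.traj i) ∧
        IdentifiesParameters (selectedTrajs (π.poly i) w) (π.traj i)) ∧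
    -- truly stable derivations, with respect to all trajectories
    (∀ π : ℕ → ℕ → PTrop D, (∀ m p, (π m p).Collects i m p) →
      ∀ m p, (StableAt π i m p ∨ (π m p).poly i = newtonMin (trajectoryWeights M i)) →
        ∀ w, IsTraceback M i ((π m p).poly i) w →
          IdentifiesMostLikely M i (selectedTrajs ((π m p).poly i) w) (trajectoryWeights M i) ∧
          IdentifiesParameters (selectedTrajs ((π m p).poly i) w) (trajectoryWeights M i)) := by
  refine ⟨fun m p => ⟨_, PTrop.collects_collect D i m p⟩, fun π => ?_, fun π hπ m p h w hw => ?_⟩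
  · refine ⟨π.traj_subset i, ?_, fun w hw =>
      ⟨(π.dominates_traj i).identifiesMostLikely (π.finite_poly i) hw,
        (π.dominates_traj i).identifiesParameters w⟩⟩
    -- The membership hypothesis is placed under the quantifier so that choice yields a total
    -- function; its values outside the polynomial are irrelevant.
    have h : ∀ μ : Mono n, ∃ w, μ ∈ π.poly i → Trajectory M i μ w := fun μ => by
      by_cases hμ : μ ∈ π.poly i
      · obtain ⟨w, hw⟩ := π.traj_subset i ((π.dominates_traj i).subset hμ)
        exact ⟨w, fun _ => hw⟩
      · exact ⟨[], fun h => absurd h hμ⟩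
    choose w hw using h
    exact ⟨w, hw⟩
  · have hdom : Dominates ((π m p).poly i) (trajectoryWeights M i) := by
      rcases h with h | h
      · exact h.dominates hπ
      · exact h ▸ (Dominates.refl _).newtonMin
    exact ⟨hdom.identifiesMostLikely ((π m p).finite_poly i) hw, hdom.identifiesParameters w⟩
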